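/- Consider $n=4$ bins, initially empty, in the insertion/deletion model: an oblivious adversary fixes in advance a finite sequence of operations, each of which either inserts a new ball (one that has never been present before) or deletes a ball that is currently present, in such a way that at most $m$ balls are present at any time. Whenever a ball is inserted, an ordered pair $(h_1,h_2)$ of distinct bins is drawn uniformly at random, independently of everything before, and the strategy Greedy places the ball into whichever of the bins $h_1,h_2$ currently contains fewer balls (into $h_1$ if the two contain equally many, which breaks ties uniformly at random). Theorem. There are constants $c>0$, $p>0$ and $C,d,m_0\in\mathbb{N}$ such that for every integer $m\ge m_0$ there is such a sequence, consisting of at most $C\,m^{d}$ insertions and deletions with at most $m$ balls present at any time, for which, after the whole sequence has been performed, with probability at least $p$ some bin contains at least $m/4+c\sqrt{m}$ balls. (That is, some oblivious sequence of $\operatorname{poly}(m)$ insertions/deletions leaves a bin with $m/4+\Omega(\sqrt m)$ balls, with probability $\Omega(1)$.) -/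

import Mathlib

namespace TwoChoice

/-- An operation of the adversary. Balls are named by natural numbers. -/
inductive Op where
  | insert (x : ℕ)
  | delete (x : ℕ)

/-- `Admissible m used present σ`: starting from the moment when the balls in `used` have been
inserted at some time and those in `present` are still there, the operations `σ` respect the
insertion/deletion model with at most `m` balls present at any time. Every inserted ball is new
(it has never been present before), and every deleted ball is currently present. -/
def Admissible (m : ℕ) : Finset ℕ → Finset ℕ → List Op → Prop
  | _, _, [] => True
  | used, present, Op.insert x :: σ =>
      x ∉ used ∧ present.card + 1 ≤ m ∧ Admissible m (insert x used) (insert x present) σ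
  | used, present, Op.delete x :: σ =>
      x ∈ present ∧ Admissible m used (present.erase x) σ

/-- A state of the system: for each bin, the set of balls it holds. -/
abbrev State (B : Type) := B → Finset ℕ

/-- The empty system. -/
def State.empty (B : Type) : State B := fun _ => ∅

/-- The load of a bin is the number of balls in it. -/
def load {B : Type} (s : State B) (b : B) : ℕ := (s b).card

/-- The possible hashes of a ball: ordered pairs of distinct bins. -/
abbrev Hash (B : Type) := {p : B × B // p.1 ≠ p.2}

instance {B : Type} [Nontrivial B] : Nonempty (Hash B) :=
  let ⟨a, b, h⟩ := exists_pair_ne B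
  ⟨⟨(a, b), h⟩⟩

/-- Greedy places the ball into the less loaded of its two bins. If the loads are equal, it takes
the first one; as the ordered pair is uniform, this breaks ties uniformly at random. -/
def greedy {B : Type} (s : State B) (h : Hash B) : B :=
  if load s h.1.1 ≤ load s h.1.2 then h.1.1 else h.1.2

/-- Put the ball `x` into the bin `b`. -/
def place {B : Type} [DecidableEq B] (s : State B) (x : ℕ) (b : B) : State B :=
  Function.update s b (insert x (s b))

/-- The random state after one operation. An insertion draws a fresh uniformly random hash and
applies the insertion strategy `strat`; a deletion removes the ball from the bin that holds it. -/
noncomputable def step {B : Type} [Fintype B] [DecidableEq B] [Nontrivial B]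
    (strat : State B → Hash B → B) : Op → State B → PMF (State B)
  | Op.insert x, s =>
      (PMF.uniformOfFintype (Hash B)).map fun h => place s x (strat s h)
  | Op.delete x, s => PMF.pure fun b => (s b).erase x

/-- The random state after all operations of a fixed sequence, from a given state; the hashes
drawn by different insertions are independent. -/
noncomputable def run {B : Type} [Fintype B] [DecidableEq B] [Nontrivial B]
    (strat : State B → Hash B → B) : List Op → State B → PMF (State B)
  | [], s => PMF.pure s
  | o :: σ, s => (step strat o s).bind (run strat σ)

end TwoChoice

/-!
Why oblivious deletions make Greedy on four bins as bad as single choice.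

The state matters only through its load vector, so the process is described by averaging operators on
functions of the load vector: `G` for one insertion, and `R` for a *round*. In a round, a single block
of `m / 2` balls is present; a second block of this size is inserted, and the first one is deleted.
Greedy balances the sum of the two blocks, so the loads of the new block are those of the old one,
reversed, plus an error.

*The error has almost mean zero.* Two bins of different loads drift towards each other
(`prob_add_le_prob`), so they meet within a linear number of insertions, up to an exponentially small
probability. From then on their difference is symmetrically distributed, since Greedy does not
distinguish bins (`G_pow_gap_sub_le`). The error does not degenerate (`le_G_pow_one_sub_cos`), and it
has bounded exponential moments (`G_pow_exp_le`). So from round to round, up to the sign, the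
difference of two loads of the block performs an unbiased random walk. The expectation of a clipped
cosine of the difference is bounded, but it would fall in each of quadratically many rounds if the
difference rarely reached linear size. Thus there is a fixed number of rounds after which it has
linear size with probability bounded away from `0` (`exists_round_gap`).

*From an uneven block to a heavy bin.* In an uneven block some set `B` of bins is lighter than all
others by a linear amount (`exists_split`). One more round, which reverses the differences, makes one
or two bins light if there were three (`half_le_R_good`). Now insert a sample of linear size `q`: as
long as `B` consists of the lightest bins, each ball falls into `B` independently, with a fixed
probability `r`. Then fill up to `m` balls, delete the sample, and insert `q` new balls. Each of these
falls into `B` with conditional probability at most `r`, whatever Greedy does. So with probability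
bounded away from `0`, the sample puts at least `r * q + √q / 100` balls into `B`, and its replacement
at most `r * q - √q / 100` (`le_walk_tail`). If no bin was heavy at the moment when the bins were
filled up, then `B` now has a deficit of order `√m`, and since all `m` balls are present, another bin
is heavy (`le_resample_of_split`). If some bin was likely to be heavy at that moment, then the
adversary just stops there (`exists_heavy_round`).
-/

namespace TwoChoice

open Finset

/-! ### Greedy on load vectors -/

/-- The loads of the four bins. Integers rather than naturals, so that the loads of a block of balls
can be written as a difference of two load vectors. -/
abbrev Loads := Fin 4 → ℤ

/-- For two distinct bins with loads `u` and `v`, the number of their two orderings for which Greedy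
chooses the bin of load `u`. -/
noncomputable def wins (u v : ℤ) : ℝ := (if u ≤ v then 1 else 0) + (if u < v then 1 else 0)

/-- The probability that Greedy places the next ball into the bin `b`. The bin `b` is itself among
the summands, hence the correction `wins u u = 1`; there are twelve hashes. -/
noncomputable def prob (y : Loads) (b : Fin 4) : ℝ := (∑ k, wins (y b) (y k) - 1) / 12

lemma wins_self (u : ℤ) : wins u u = 1 := by simp [wins]

lemma wins_nonneg (u v : ℤ) : 0 ≤ wins u v := by
  unfold wins; positivity

lemma wins_le_two (u v : ℤ) : wins u v ≤ 2 := by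
  unfold wins; split_ifs <;> norm_num

lemma wins_of_lt {u v : ℤ} (h : u < v) : wins u v = 2 := by
  simp [wins, h, h.le]; norm_num

lemma wins_of_gt {u v : ℤ} (h : v < u) : wins u v = 0 := by
  simp [wins, h, not_lt.2 h.le]

lemma wins_add_wins (u v : ℤ) : wins u v + wins v u = 2 := by
  rcases lt_trichotomy u v with h | h | h
  · rw [wins_of_lt h, wins_of_gt h]; norm_num
  · subst h; rw [wins_self]; norm_num
  · rw [wins_of_lt h, wins_of_gt h]; norm_num

lemma wins_anti {u u' : ℤ} (h : u ≤ u') (v : ℤ) : wins u' v ≤ wins u v := by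
  unfold wins
  gcongr ?_ + ?_
  · split_ifs <;> first | omega | norm_num
  · split_ifs <;> first | omega | norm_num

lemma prob_nonneg (y : Loads) (b : Fin 4) : 0 ≤ prob y b := by
  have := single_le_sum (f := fun k => wins (y b) (y k)) (fun k _ => wins_nonneg _ _) (mem_univ b)
  simp only [wins_self] at this
  unfold prob; linarith

/-- A double sum of `wins` over a set of bins counts its pairs. -/
lemma sum_wins_self (y : Loads) (B : Finset (Fin 4)) :
    ∑ b ∈ B, ∑ k ∈ B, wins (y b) (y k) = (#B : ℝ) ^ 2 := by
  have h : ∑ b ∈ B, ∑ k ∈ B, wins (y b) (y k) = ∑ b ∈ B, ∑ k ∈ B, wins (y k) (y b) := sum_comm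
  have h2 : ∑ b ∈ B, ∑ k ∈ B, (wins (y b) (y k) + wins (y k) (y b)) = 2 * (#B : ℝ) ^ 2 := by
    simp only [wins_add_wins]; simp; ring
  simp only [sum_add_distrib] at h2
  linarith

lemma sum_prob_eq (y : Loads) (B : Finset (Fin 4)) :
    ∑ b ∈ B, prob y b
      = ((#B : ℝ) ^ 2 - #B + ∑ b ∈ B, ∑ k ∈ Bᶜ, wins (y b) (y k)) / 12 := by
  unfold prob
  rw [← sum_div, sum_sub_distrib, ← sum_wins_self y B]
  simp only [← sum_add_sum_compl B, sum_add_distrib, sum_const, nsmul_eq_mul, mul_one]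
  ring

lemma sum_prob (y : Loads) : ∑ b, prob y b = 1 := by
  rw [sum_prob_eq]; norm_num

/-- The probability that a set of `k` bins is hit by the hash of a ball. -/
noncomputable def hit (k : ℕ) : ℝ := k * (7 - k) / 12

lemma card_compl_four (B : Finset (Fin 4)) : (#Bᶜ : ℝ) = 4 - #B := by
  have := card_add_card_compl B
  simp only [Fintype.card_fin] at this
  rw [← Nat.cast_inj (R := ℝ)] at this
  push_cast at this; linarith

lemma sum_prob_le_hit (y : Loads) (B : Finset (Fin 4)) : ∑ b ∈ B, prob y b ≤ hit #B := by
  have : ∑ b ∈ B, ∑ k ∈ Bᶜ, wins (y b) (y k) ≤ ∑ b ∈ B, ∑ k ∈ Bᶜ, (2 : ℝ) :=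
    sum_le_sum fun b _ => sum_le_sum fun k _ => wins_le_two _ _
  simp only [sum_const, nsmul_eq_mul, card_compl_four] at this
  rw [sum_prob_eq, hit]
  linarith

lemma sum_prob_eq_hit (y : Loads) (B : Finset (Fin 4)) (h : ∀ b ∈ B, ∀ a ∉ B, y b < y a) :
    ∑ b ∈ B, prob y b = hit #B := by
  have : ∑ b ∈ B, ∑ k ∈ Bᶜ, wins (y b) (y k) = ∑ b ∈ B, ∑ k ∈ Bᶜ, (2 : ℝ) :=
    sum_congr rfl fun b hb => sum_congr rfl fun k hk => wins_of_lt (h b hb k (mem_compl.1 hk))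
  simp only [sum_const, nsmul_eq_mul, card_compl_four] at this
  rw [sum_prob_eq, hit, this]
  ring

lemma prob_le_half (y : Loads) (b : Fin 4) : prob y b ≤ 1 / 2 := by
  have := sum_prob_le_hit y {b}
  simp [hit] at this
  linarith

/-- The less loaded of two bins is favoured by at least `1/6`, which is the probability that the hash
consists of just these two bins. -/
lemma prob_add_le_prob (y : Loads) {i j : Fin 4} (h : y j < y i) : prob y i + 1 / 6 ≤ prob y j := by
  have hij : j ≠ i := by rintro rfl; exact lt_irrefl _ h
  have h1 : ∀ k, 0 ≤ wins (y j) (y k) - wins (y i) (y k) :=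
    fun k => sub_nonneg.2 (wins_anti h.le _)
  have h2 := sum_le_sum_of_subset_of_nonneg (f := fun k => wins (y j) (y k) - wins (y i) (y k))
    (subset_univ {i, j}) (fun k _ _ => h1 k)
  rw [sum_pair hij.symm, sum_sub_distrib, wins_self, wins_self, wins_of_lt h, wins_of_gt h] at h2
  unfold prob; linarith

lemma prob_add_prob_le (y : Loads) {i j : Fin 4} (h : i ≠ j) : prob y i + prob y j ≤ 5 / 6 := by
  have := sum_prob_le_hit y {i, j}
  rw [sum_pair h, card_pair h] at this
  norm_num [hit] at this
  linarith

lemma le_prob_add_prob (y : Loads) {i j : Fin 4} (h : i ≠ j) : 1 / 6 ≤ prob y i + prob y j := by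
  have := sum_prob_eq y {i, j}
  rw [sum_pair h, card_pair h] at this
  have h2 : 0 ≤ ∑ b ∈ ({i, j} : Finset (Fin 4)), ∑ k ∈ ({i, j} : Finset (Fin 4))ᶜ, wins (y b) (y k) :=
    sum_nonneg fun b _ => sum_nonneg fun k _ => wins_nonneg _ _
  push_cast at this
  linarith

lemma prob_comp (y : Loads) (π : Equiv.Perm (Fin 4)) (b : Fin 4) :
    prob (y ∘ π) b = prob y (π b) := by
  simp only [prob, Function.comp_apply]
  rw [Equiv.sum_comp π (fun k => wins (y (π b)) (y k))]

/-- Averaging over the twelve hashes is the same as averaging over the receiving bin. -/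
lemma sum_hash (y : Loads) (φ : Fin 4 → ℝ) :
    ∑ h : Hash (Fin 4), φ (if y h.1.1 ≤ y h.1.2 then h.1.1 else h.1.2)
      = 12 * ∑ b, prob y b * φ b := by
  have h1 : ∑ h : Hash (Fin 4), φ (if y h.1.1 ≤ y h.1.2 then h.1.1 else h.1.2)
      = ∑ a, ∑ b, (φ (if y a ≤ y b then a else b) - if a = b then φ a else 0) := by
    rw [← Fintype.sum_prod_type' (f := fun a b =>
      φ (if y a ≤ y b then a else b) - if a = b then φ a else 0),
      ← Fintype.sum_subtype_add_sum_subtype (fun p : Fin 4 × Fin 4 => p.1 ≠ p.2)]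
    have h0 : ∑ x : {p : Fin 4 × Fin 4 // ¬ p.1 ≠ p.2},
        (φ (if y x.1.1 ≤ y x.1.2 then x.1.1 else x.1.2) - if x.1.1 = x.1.2 then φ x.1.1 else 0)
          = 0 := by
      refine sum_eq_zero fun x _ => ?_
      have := not_not.1 x.2
      simp [this]
    rw [h0, add_zero]
    refine sum_congr rfl fun x _ => ?_
    simp [x.2]
  have h2 : ∀ a b : Fin 4, φ (if y a ≤ y b then a else b)
      = (if y a ≤ y b then φ a else 0) + (if y b < y a then φ b else 0) := by
    intro a b
    by_cases h : y a ≤ y b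
    · simp [h, not_lt.2 h]
    · simp [h, not_le.1 h]
  rw [h1]
  simp only [h2, sum_sub_distrib, sum_add_distrib]
  rw [sum_comm (f := fun a b => if y b < y a then φ b else 0)]
  simp only [prob, wins, mul_sum, ← sum_add_distrib, ← sum_sub_distrib]
  refine sum_congr rfl fun a _ => ?_
  have : ∀ (p : Fin 4 → Prop) [DecidablePred p], ∑ b, (if p b then φ a else 0)
      = (∑ b, if p b then (1:ℝ) else 0) * φ a := by
    intro p _; rw [sum_mul]; exact sum_congr rfl fun b _ => by split_ifs <;> simp
  rw [sum_sub_distrib, sum_add_distrib, this, this, sum_add_distrib]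
  simp
  ring

/-- The load vector after one more ball in the bin `b`. -/
def bump (y : Loads) (b : Fin 4) : Loads := y + Pi.single b 1

/-- One greedy insertion, as an averaging operator on functions of the load vector. -/
noncomputable def G : Module.End ℝ (Loads → ℝ) where
  toFun f y := ∑ b, prob y b * f (bump y b)
  map_add' f g := by ext y; simp [mul_add, sum_add_distrib]
  map_smul' c f := by ext y; simp [mul_sum, mul_left_comm]

lemma G_apply (f : Loads → ℝ) (y : Loads) : G f y = ∑ b, prob y b * f (bump y b) := rfl

/-- An averaging operator: positive and normalized. -/
structure IsMarkov (A : Module.End ℝ (Loads → ℝ)) : Prop where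
  mono : ∀ f g : Loads → ℝ, f ≤ g → A f ≤ A g
  const : ∀ c : ℝ, (A fun _ => c) = fun _ => c

lemma isMarkov_G : IsMarkov G where
  mono f g h y := by
    rw [G_apply, G_apply]
    exact sum_le_sum fun b _ => mul_le_mul_of_nonneg_left (h _) (prob_nonneg _ _)
  const c := by ext y; rw [G_apply, ← sum_mul, sum_prob, one_mul]

lemma IsMarkov.pow {A : Module.End ℝ (Loads → ℝ)} (hA : IsMarkov A) (n : ℕ) : IsMarkov (A ^ n) := by
  induction n with
  | zero => exact ⟨fun f g h => h, fun c => rfl⟩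
  | succ n ih =>
    refine ⟨fun f g h => ?_, fun c => ?_⟩
    · rw [pow_succ]; exact ih.mono _ _ (hA.mono _ _ h)
    · rw [pow_succ, Module.End.mul_apply, hA.const, ih.const]

lemma G_pow_succ (n : ℕ) (f : Loads → ℝ) (y : Loads) :
    (G ^ (n + 1)) f y = ∑ b, prob y b * (G ^ n) f (bump y b) := by
  rw [pow_succ', Module.End.mul_apply, G_apply]

/-- If a property of the load vector is kept by insertions, then only the values of `f` at load
vectors with this property matter. -/
lemma G_pow_mono_of_inv (I : ℕ → Loads → Prop) (hI : ∀ n y b, I n y → I (n + 1) (bump y b))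
    (f g : Loads → ℝ) (n k : ℕ) (h : ∀ y, I (n + k) y → f y ≤ g y) (y : Loads) (hy : I k y) :
    (G ^ n) f y ≤ (G ^ n) g y := by
  induction n generalizing k y with
  | zero => exact h y (by simpa using hy)
  | succ n ih =>
    rw [G_pow_succ, G_pow_succ]
    refine sum_le_sum fun b _ => mul_le_mul_of_nonneg_left ?_ (prob_nonneg _ _)
    exact ih (k + 1) (fun y hy' => h y (by convert hy' using 1; ring)) _ (hI _ _ _ hy)

lemma bump_comp (y : Loads) (π : Equiv.Perm (Fin 4)) (b : Fin 4) :
    bump (y ∘ π) b = bump y (π b) ∘ π := by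
  ext k
  simp [bump, Pi.single_apply]

/-- Greedy does not distinguish the bins. -/
lemma G_pow_comp (π : Equiv.Perm (Fin 4)) (n : ℕ) (f : Loads → ℝ) (y : Loads) :
    (G ^ n) f (y ∘ π) = (G ^ n) (fun L => f (L ∘ π)) y := by
  induction n generalizing y with
  | zero => rfl
  | succ n ih =>
    rw [G_pow_succ, G_pow_succ]
    simp only [prob_comp, bump_comp, ih]
    exact Equiv.sum_comp π (fun b => prob y b * (G ^ n) (fun L => f (L ∘ π)) (bump y b))

/-! ### The difference of two loads -/

/-- How much more the bin `i` holds than the bin `j`. -/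
def gap (i j : Fin 4) (y : Loads) : ℤ := y i - y j

lemma gap_bump (i j : Fin 4) (y : Loads) (b : Fin 4) :
    gap i j (bump y b) = gap i j y + ((if i = b then 1 else 0) - (if j = b then 1 else 0)) := by
  simp only [gap, bump, Pi.add_apply, Pi.single_apply]
  ring

lemma G_gap {i j : Fin 4} (hij : i ≠ j) (φ : ℤ → ℝ) (y : Loads) :
    G (fun L => φ (gap i j L)) y = prob y i * φ (gap i j y + 1) + prob y j * φ (gap i j y - 1)
      + (1 - prob y i - prob y j) * φ (gap i j y) := by
  have h : ∀ b, prob y b * φ (gap i j (bump y b)) = prob y b * φ (gap i j y)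
      + (if i = b then prob y i * (φ (gap i j y + 1) - φ (gap i j y)) else 0)
      + (if j = b then prob y j * (φ (gap i j y - 1) - φ (gap i j y)) else 0) := by
    intro b
    rw [gap_bump]
    by_cases h1 : i = b
    · subst h1
      simp [hij.symm]; ring
    · by_cases h2 : j = b
      · subst h2
        simp [hij, sub_eq_add_neg]; ring
      · simp [h1, h2]
  rw [G_apply]
  simp only [h, sum_add_distrib, sum_ite_eq, mem_univ, if_true, ← sum_mul, sum_prob]
  ring

/-- The arithmetic of one step, for a move away from `0` with probability `p` and towards `0` with
probability `r`. -/
lemma exp_step_pos {p r w : ℝ} (hw : 0 ≤ w) (hr : r ≤ 1 / 2) (hpr : p + 1 / 6 ≤ r) :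
    p * (7 / 6 * (7 / 6 * w)) + r * w + (1 - p - r) * (7 / 6 * w) ≤ 71 / 72 * (7 / 6 * w) := by
  have : p * (7 / 6 * (7 / 6)) + r + (1 - p - r) * (7 / 6) ≤ 71 / 72 * (7 / 6) := by linarith
  nlinarith [mul_le_mul_of_nonneg_right this hw]

/-- The exponential potential of the difference of two loads shrinks as long as the loads differ. -/
lemma G_exp_of_ne {i j : Fin 4} (hij : i ≠ j) {y : Loads} (h : gap i j y ≠ 0) :
    G (fun L => (7 / 6 : ℝ) ^ (gap i j L).natAbs) y ≤ 71 / 72 * (7 / 6) ^ (gap i j y).natAbs := by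
  rw [G_gap hij (fun d => (7 / 6 : ℝ) ^ d.natAbs)]
  obtain ⟨k, hk⟩ : ∃ k, (gap i j y).natAbs = k + 1 :=
    Nat.exists_eq_succ_of_ne_zero (Int.natAbs_ne_zero.2 h)
  rcases lt_or_gt_of_ne h with h0 | h0
  · have e1 : (gap i j y + 1).natAbs = k := by omega
    have e2 : (gap i j y - 1).natAbs = k + 1 + 1 := by omega
    rw [e1, e2, hk, pow_succ' _ (k + 1), pow_succ' _ k]
    have := exp_step_pos (w := (7 / 6 : ℝ) ^ k) (by positivity) (prob_le_half y i)
      (prob_add_le_prob y (i := j) (j := i) (by unfold gap at h0; omega))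
    linarith
  · have e1 : (gap i j y - 1).natAbs = k := by omega
    have e2 : (gap i j y + 1).natAbs = k + 1 + 1 := by omega
    rw [e1, e2, hk, pow_succ' _ (k + 1), pow_succ' _ k]
    exact exp_step_pos (by positivity) (prob_le_half y j)
      (prob_add_le_prob y (by unfold gap at h0; omega))

lemma G_exp_le {i j : Fin 4} (hij : i ≠ j) (y : Loads) :
    G (fun L => (7 / 6 : ℝ) ^ (gap i j L).natAbs) y
      ≤ 71 / 72 * (7 / 6) ^ (gap i j y).natAbs + 7 / 6 := by
  by_cases h : gap i j y = 0
  · rw [G_gap hij (fun d => (7 / 6 : ℝ) ^ d.natAbs), h]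
    have := prob_add_prob_le y hij
    norm_num
    linarith
  · have := G_exp_of_ne hij h
    linarith

/-- After `n` insertions only an exponentially small part of the initial difference of two loads is
left, apart from a bounded exponential moment. -/
lemma G_pow_exp_le {i j : Fin 4} (hij : i ≠ j) (n : ℕ) (y : Loads) :
    (G ^ n) (fun L => (7 / 6 : ℝ) ^ (gap i j L).natAbs) y
      ≤ (71 / 72) ^ n * (7 / 6) ^ (gap i j y).natAbs + 84 := by
  suffices h : (G ^ n) (fun L => (7 / 6 : ℝ) ^ (gap i j L).natAbs) y
      ≤ (71 / 72) ^ n * (7 / 6) ^ (gap i j y).natAbs + 84 * (1 - (71 / 72) ^ n) by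
    have : (0 : ℝ) ≤ (71 / 72) ^ n := by positivity
    linarith
  induction n generalizing y with
  | zero => simp
  | succ n ih =>
    rw [G_pow_succ]
    have h1 : ∑ b, prob y b * (G ^ n) (fun L => (7 / 6 : ℝ) ^ (gap i j L).natAbs) (bump y b)
        ≤ ∑ b, prob y b * ((71 / 72) ^ n * (7 / 6) ^ (gap i j (bump y b)).natAbs
          + 84 * (1 - (71 / 72) ^ n)) :=
      sum_le_sum fun b _ => mul_le_mul_of_nonneg_left (ih _) (prob_nonneg _ _)
    refine h1.trans ?_
    have h2 := mul_le_mul_of_nonneg_left (G_exp_le hij y)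
      (show (0 : ℝ) ≤ (71 / 72) ^ n by positivity)
    rw [G_apply, mul_sum] at h2
    simp only [mul_add, sum_add_distrib, ← sum_mul, sum_prob]
    simp only [mul_left_comm _ (prob y _)] at h2
    rw [pow_succ]
    linarith

/-- Once the loads of two bins are equal, their difference has a symmetric distribution at every
later time, because Greedy does not distinguish the two bins. Hence the asymmetry of the difference
is bounded by the probability that the loads have not met yet. -/
lemma G_pow_gap_sub_le {i j : Fin 4} (hij : i ≠ j) {f : ℤ → ℝ} (hf : ∀ d, |f d| ≤ 1) (n : ℕ)
    (y : Loads) :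
    (G ^ n) (fun L => f (gap i j L)) y - (G ^ n) (fun L => f (-gap i j L)) y
      ≤ 2 * ((71 / 72) ^ n * (7 / 6) ^ (gap i j y).natAbs) := by
  induction n generalizing y with
  | zero =>
    have h1 := abs_le.1 (hf (gap i j y))
    have h2 := abs_le.1 (hf (-gap i j y))
    have : (1 : ℝ) ≤ (7 / 6) ^ (gap i j y).natAbs := one_le_pow₀ (by norm_num)
    simp only [pow_zero, Module.End.one_apply, one_mul]
    linarith
  | succ n ih =>
    by_cases h : gap i j y = 0
    · -- equal loads: exchanging the two bins leaves `y` unchanged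
      have hy : y ∘ Equiv.swap i j = y := by
        unfold gap at h
        ext k
        simp only [Function.comp_apply, Equiv.swap_apply_def]
        split_ifs with h1 h2
        · subst h1; omega
        · subst h2; omega
        · rfl
      have h1 := G_pow_comp (Equiv.swap i j) (n + 1) (fun L => f (gap i j L)) y
      have h2 : ∀ L : Loads, gap i j (L ∘ Equiv.swap i j) = -gap i j L := by
        intro L; simp [gap]
      simp only [hy, h2] at h1
      rw [h1, sub_self]
      positivity
    · rw [G_pow_succ, G_pow_succ, ← sum_sub_distrib]
      have h1 : ∑ b, (prob y b * (G ^ n) (fun L => f (gap i j L)) (bump y b)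
            - prob y b * (G ^ n) (fun L => f (-gap i j L)) (bump y b))
          ≤ ∑ b, prob y b * (2 * ((71 / 72) ^ n * (7 / 6) ^ (gap i j (bump y b)).natAbs)) := by
        refine sum_le_sum fun b _ => ?_
        rw [← mul_sub]
        exact mul_le_mul_of_nonneg_left (ih _) (prob_nonneg _ _)
      refine h1.trans ?_
      have h2 := mul_le_mul_of_nonneg_left (G_exp_of_ne hij h)
        (show (0 : ℝ) ≤ 2 * (71 / 72) ^ n by positivity)
      rw [G_apply, mul_sum] at h2
      refine (le_of_eq (sum_congr rfl fun b _ => by ring)).trans (h2.trans (le_of_eq ?_))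
      rw [pow_succ]; ring

/-! ### A trigonometric potential -/

lemma two_mul_one_sub_cos_le {θ : ℝ} (hθ : 0 ≤ Real.cos (θ / 2)) (x : ℝ) :
    2 * (1 - Real.cos (θ / 2)) ≤ (1 - Real.cos x) + (1 - Real.cos (x + θ)) := by
  have h : Real.cos x + Real.cos (x + θ) = 2 * Real.cos (θ / 2) * Real.cos (x + θ / 2) := by
    have e1 : Real.cos x = Real.cos ((x + θ / 2) - θ / 2) := by congr 1; ring
    have e2 : Real.cos (x + θ) = Real.cos ((x + θ / 2) + θ / 2) := by congr 1; ring
    rw [e1, e2, Real.cos_add, Real.cos_sub]; ring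
  nlinarith [mul_nonneg hθ (sub_nonneg.2 (Real.cos_le_one (x + θ / 2)))]

/-- The last insertion alone keeps the difference of two loads away from being `0`: it both moves
the difference and leaves it unchanged with probability at least `1/6`. -/
lemma le_G_one_sub_cos {i j : Fin 4} (hij : i ≠ j) {θ : ℝ} (hθ : 0 ≤ Real.cos (θ / 2))
    (y : Loads) :
    (1 - Real.cos (θ / 2)) / 3 ≤ G (fun L => 1 - Real.cos (θ * gap i j L)) y := by
  rw [G_gap hij (fun d => 1 - Real.cos (θ * d))]
  have hc : ∀ x, 0 ≤ 1 - Real.cos x := fun x => sub_nonneg.2 (Real.cos_le_one x)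
  have hs := prob_add_prob_le y hij
  have hi := prob_nonneg y i
  have hj := prob_nonneg y j
  rcases lt_trichotomy (gap i j y) 0 with h | h | h
  · have h1 := prob_add_le_prob y (i := j) (j := i) (by unfold gap at h; omega)
    have h2 := two_mul_one_sub_cos_le hθ (θ * gap i j y)
    have e : θ * ((gap i j y + 1 : ℤ) : ℝ) = θ * gap i j y + θ := by push_cast; ring
    rw [e]
    nlinarith [mul_nonneg hj (hc (θ * ((gap i j y - 1 : ℤ) : ℝ))), hc (θ * gap i j y),
      hc (θ * gap i j y + θ)]
  · have h1 := le_prob_add_prob y hij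
    have h2 := two_mul_one_sub_cos_le hθ 0
    rw [h]
    norm_num at h2 ⊢
    nlinarith [hc θ]
  · have h1 := prob_add_le_prob y (i := i) (j := j) (by unfold gap at h; omega)
    have h2 := two_mul_one_sub_cos_le hθ (θ * ((gap i j y - 1 : ℤ) : ℝ))
    have e : θ * ((gap i j y - 1 : ℤ) : ℝ) + θ = θ * gap i j y := by push_cast; ring
    rw [e] at h2
    nlinarith [mul_nonneg hi (hc (θ * ((gap i j y + 1 : ℤ) : ℝ))), hc (θ * gap i j y),
      hc (θ * ((gap i j y - 1 : ℤ) : ℝ))]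

lemma le_G_pow_one_sub_cos {i j : Fin 4} (hij : i ≠ j) {θ : ℝ} (hθ : 0 ≤ Real.cos (θ / 2))
    {n : ℕ} (hn : n ≠ 0) (y : Loads) :
    (1 - Real.cos (θ / 2)) / 3 ≤ (G ^ n) (fun L => 1 - Real.cos (θ * gap i j L)) y := by
  obtain ⟨n, rfl⟩ := Nat.exists_eq_succ_of_ne_zero hn
  have h := (isMarkov_G.pow n).mono _ _ (le_G_one_sub_cos hij hθ)
  rw [(isMarkov_G.pow n).const] at h
  rw [Nat.succ_eq_add_one, pow_succ]
  exact h y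

lemma sq_le_exp (k : ℕ) : (k : ℝ) ^ 2 ≤ 72 * (7 / 6) ^ k := by
  suffices h : 1 + (k : ℝ) / 6 + k * (k - 1) / 72 ≤ (7 / 6) ^ k by
    have : (0 : ℝ) ≤ k := k.cast_nonneg
    nlinarith
  induction k with
  | zero => simp
  | succ k ih =>
    have h0 : (0 : ℝ) ≤ k := k.cast_nonneg
    have h1 : (0 : ℝ) ≤ k * (k - 1) := by
      rcases k with _ | k
      · simp
      · push_cast; rw [add_sub_cancel_right]; positivity
    rw [pow_succ]
    push_cast
    nlinarith

/-- The cosine of `θ d`, made constant beyond the first half period. -/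
noncomputable def clip (θ : ℝ) (d : ℤ) : ℝ := Real.cos (min |θ * d| Real.pi)

lemma abs_clip_le (θ : ℝ) (d : ℤ) : |clip θ d| ≤ 1 := Real.abs_cos_le_one _

lemma clip_of_le {θ : ℝ} {d : ℤ} (h : |θ * d| ≤ Real.pi) : clip θ d = Real.cos (θ * d) := by
  rw [clip, min_eq_left h, Real.cos_abs]

lemma clip_of_ge {θ : ℝ} {d : ℤ} (h : Real.pi ≤ |θ * d|) : clip θ d = -1 := by
  rw [clip, min_eq_right h, Real.cos_pi]

lemma clip_le_cos (θ : ℝ) (d : ℤ) : clip θ d ≤ Real.cos (θ * d) := by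
  rcases le_total |θ * d| Real.pi with h | h
  · rw [clip_of_le h]
  · rw [clip_of_ge h]; exact Real.neg_one_le_cos _

lemma clip_le_sq {θ : ℝ} {d : ℤ} {u : ℝ} (hu : Real.pi - |θ * d| ≤ u) :
    clip θ d ≤ -1 + u ^ 2 / 2 := by
  rcases le_total |θ * d| Real.pi with h | h
  · have h1 := Real.one_sub_sq_div_two_le_cos (x := Real.pi - |θ * d|)
    rw [Real.cos_pi_sub, Real.cos_abs] at h1
    rw [clip_of_le h]
    have : (Real.pi - |θ * d|) ^ 2 ≤ u ^ 2 := by gcongr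
    linarith
  · rw [clip_of_ge h]
    have : 0 ≤ u ^ 2 := by positivity
    linarith

/-! ### Rounds -/

lemma IsMarkov.affine {A : Module.End ℝ (Loads → ℝ)} (hA : IsMarkov A) (a c : ℝ)
    (g : Loads → ℝ) (y : Loads) : A (fun L => a + c * g L) y = a + c * A g y := by
  have h : (fun L => a + c * g L) = (fun _ => a) + c • g := by ext; simp
  rw [h, map_add, map_smul, hA.const]
  simp

/-- A round of the adversary: when only a block of `s` balls with loads `y` is present, `s` new balls
are inserted, and then the old block is deleted. The remaining loads are those of the new block. -/
noncomputable def R (s : ℕ) : Module.End ℝ (Loads → ℝ) where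
  toFun f y := (G ^ s) (fun L => f (L - y)) y
  map_add' f g := by
    ext y
    exact congrFun (map_add (G ^ s) (fun L => f (L - y)) (fun L => g (L - y))) y
  map_smul' c f := by
    ext y
    exact congrFun (map_smul (G ^ s) c (fun L => f (L - y))) y

lemma R_apply (s : ℕ) (f : Loads → ℝ) (y : Loads) :
    R s f y = (G ^ s) (fun L => f (L - y)) y := rfl

lemma isMarkov_R (s : ℕ) : IsMarkov (R s) where
  mono f g h y := (isMarkov_G.pow s).mono _ _ (fun L => h (L - y)) y
  const c := by ext y; rw [R_apply, (isMarkov_G.pow s).const]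

lemma gap_sub (i j : Fin 4) (L y : Loads) : gap i j (L - y) = gap i j L - gap i j y := by
  simp only [gap, Pi.sub_apply]; ring

/-- Fifty insertions for every unit of difference are more than enough for two loads to meet. -/
lemma decay_le {D s k : ℕ} (hs : 50 * D ≤ s) (hk : k ≤ D) :
    (71 / 72 : ℝ) ^ s * (7 / 6) ^ k ≤ (3 / 5) ^ D := by
  calc (71 / 72 : ℝ) ^ s * (7 / 6) ^ k
      ≤ (71 / 72 : ℝ) ^ (50 * D) * (7 / 6) ^ D := by
        gcongr ?_ * ?_
        · exact pow_le_pow_of_le_one (by norm_num) (by norm_num) hs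
        · exact pow_le_pow_right₀ (by norm_num) hk
    _ = ((71 / 72 : ℝ) ^ 50 * (7 / 6)) ^ D := by rw [pow_mul, mul_pow]
    _ ≤ (3 / 5) ^ D := by
        gcongr
        norm_num

lemma G_pow_exp_le_of_le {i j : Fin 4} (hij : i ≠ j) {D s : ℕ} (hs : 50 * D ≤ s) {y : Loads}
    (hy : (gap i j y).natAbs ≤ D) :
    (G ^ s) (fun L => (7 / 6 : ℝ) ^ (gap i j L).natAbs) y ≤ 85 := by
  have h1 := G_pow_exp_le hij s y
  have h2 := decay_le hs hy
  have h3 : (3 / 5 : ℝ) ^ D ≤ 1 := pow_le_one₀ (by norm_num) (by norm_num)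
  linarith

/-- How far the expected potential may rise in one round: it falls by a definite amount while the
difference is small, since the new difference is the old one, reversed, plus a symmetric error. -/
noncomputable def drift (D : ℕ) (d : ℤ) : ℝ :=
  if 3 * d.natAbs ≤ D then -1 / (12 * D ^ 2) else 30600 / D ^ 2

lemma pi_sq_lt_ten : Real.pi ^ 2 < 10 := by
  have := Real.pi_lt_d2
  have := Real.pi_pos
  nlinarith

/-- While the difference has not left the first half period, a round reverses it up to an almost
symmetric error, and the addition theorem for the cosine applies. -/
lemma R_clip_le_of_le {i j : Fin 4} (hij : i ≠ j) {D s : ℕ} (hD : 1 ≤ D) (hs : 50 * D ≤ s)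
    (y : Loads) (hy : (gap i j y).natAbs ≤ D) :
    R s (fun L => clip (Real.pi / D) (gap i j L)) y
      ≤ clip (Real.pi / D) (gap i j y) + (3 / 5) ^ D + drift D (gap i j y) := by
  set θ : ℝ := Real.pi / D with hθ
  set d : ℤ := gap i j y with hd
  have hD0 : (0 : ℝ) < D := by exact_mod_cast hD
  have hθD : θ * D = Real.pi := by rw [hθ]; field_simp
  have hθ0 : 0 < θ := div_pos Real.pi_pos hD0
  have hθ2 : θ ^ 2 = Real.pi ^ 2 / D ^ 2 := by rw [hθ, div_pow]
  have hdabs : |θ * (d : ℝ)| = θ * (d.natAbs : ℝ) := by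
    rw [abs_mul, abs_of_pos hθ0, Nat.cast_natAbs, Int.cast_abs]
  have hM := isMarkov_G.pow s
  -- the expected effect of the error that the round adds
  set E : ℝ := (G ^ s) (fun L => 1 - Real.cos (θ * gap i j L)) y with hE
  have hsym := G_pow_gap_sub_le hij (f := fun x => clip θ (x - d)) (fun x => abs_clip_le _ _) s y
  -- the addition theorem, applied to the difference and its mirror image
  have hadd : (G ^ s) (fun L => clip θ (gap i j L - d)) y
      + (G ^ s) (fun L => clip θ (-gap i j L - d)) y
      ≤ 2 * Real.cos (θ * d) + (-2 * Real.cos (θ * d)) * E := by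
    rw [hE, ← hM.affine, ← Pi.add_apply, ← map_add]
    refine hM.mono _ _ (fun L => ?_) y
    have h1 := clip_le_cos θ (gap i j L - d)
    have h2 := clip_le_cos θ (-gap i j L - d)
    push_cast at h1 h2
    rw [mul_sub, Real.cos_sub] at h1
    rw [mul_sub, mul_neg, Real.cos_sub, Real.cos_neg, Real.sin_neg] at h2
    simp only [Pi.add_apply]
    linarith
  have hdec := decay_le hs hy
  have hEup : E ≤ 30600 / D ^ 2 := by
    have h1 : E ≤ 0 + (36 * θ ^ 2) * (G ^ s) (fun L => (7 / 6 : ℝ) ^ (gap i j L).natAbs) y := by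
      rw [← hM.affine]
      refine hM.mono _ _ (fun L => ?_) y
      have h1 := Real.one_sub_sq_div_two_le_cos (x := θ * gap i j L)
      have h2 := sq_le_exp (gap i j L).natAbs
      rw [Nat.cast_natAbs, Int.cast_abs, sq_abs] at h2
      have h3 := mul_le_mul_of_nonneg_left h2 (sq_nonneg θ)
      simp only
      linarith
    have h2 := G_pow_exp_le_of_le hij hs hy
    have h3 : E ≤ 3060 * θ ^ 2 := by
      have := mul_le_mul_of_nonneg_left h2 (show 0 ≤ 36 * θ ^ 2 by positivity)
      linarith
    refine h3.trans ?_
    rw [hθ2, ← mul_div_assoc]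
    gcongr
    linarith [pi_sq_lt_ten]
  have hθle : θ / 2 ≤ Real.pi / 2 := by
    have : θ ≤ Real.pi := div_le_self Real.pi_pos.le (by exact_mod_cast hD)
    linarith
  have hElow : 1 / (6 * D ^ 2) ≤ E := by
    have h1 := le_G_pow_one_sub_cos hij (θ := θ)
      (Real.cos_nonneg_of_neg_pi_div_two_le_of_le (by linarith [Real.pi_pos]) hθle)
      (n := s) (by omega) y
    have h2 := Real.cos_le_one_sub_mul_cos_sq (x := θ / 2)
      (by rw [abs_of_pos (by positivity)]; linarith [Real.pi_pos])
    have h3 : 2 / Real.pi ^ 2 * (θ / 2) ^ 2 = 1 / (2 * D ^ 2) := by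
      rw [hθ]
      have := Real.pi_ne_zero
      field_simp
    rw [h3] at h2
    have h4 : 1 / (6 * (D : ℝ) ^ 2) = 1 / (2 * D ^ 2) / 3 := by field_simp; norm_num
    rw [h4]
    linarith
  have hE0 : 0 ≤ E := le_trans (by positivity) hElow
  have hθd : |θ * (d : ℝ)| ≤ Real.pi := by
    rw [hdabs, ← hθD]
    gcongr
  have hmain : R s (fun L => clip θ (gap i j L)) y
      ≤ Real.cos (θ * d) - Real.cos (θ * d) * E + (3 / 5) ^ D := by
    rw [R_apply]
    simp only [gap_sub, ← hd]
    linarith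
  rw [clip_of_le hθd, drift]
  split_ifs with h3
  · have h4 : |θ * (d : ℝ)| ≤ Real.pi / 3 := by
      have : (3 : ℝ) * d.natAbs ≤ D := by exact_mod_cast h3
      rw [hdabs]
      nlinarith
    have h5 : 1 / 2 ≤ Real.cos (θ * d) := by
      rw [← Real.cos_abs, ← Real.cos_pi_div_three]
      exact Real.cos_le_cos_of_nonneg_of_le_pi (abs_nonneg _) (by linarith [Real.pi_pos]) h4
    have h6 : -1 / (12 * (D : ℝ) ^ 2) = -(1 / 2 * (1 / (6 * D ^ 2))) := by field_simp; norm_num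
    have h7 : 1 / 2 * (1 / (6 * (D : ℝ) ^ 2)) ≤ Real.cos (θ * d) * E := by gcongr
    rw [h6]
    linarith
  · nlinarith [Real.neg_one_le_cos (θ * d)]

/-- Beyond the first half period a round cannot bring the difference back by more than a bounded
amount, in the mean square. -/
lemma R_clip_le_of_ge {i j : Fin 4} (hij : i ≠ j) {D s : ℕ} (hD : 1 ≤ D) (hs : 50 * D ≤ s)
    (y : Loads) (hy : D ≤ (gap i j y).natAbs) :
    R s (fun L => clip (Real.pi / D) (gap i j L)) y
      ≤ clip (Real.pi / D) (gap i j y) + 30600 / D ^ 2 := by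
  set θ : ℝ := Real.pi / D with hθ
  set d : ℤ := gap i j y with hd
  have hD0 : (0 : ℝ) < D := by exact_mod_cast hD
  have hθD : θ * D = Real.pi := by rw [hθ]; field_simp
  have hθ0 : 0 < θ := div_pos Real.pi_pos hD0
  have hθ2 : θ ^ 2 = Real.pi ^ 2 / D ^ 2 := by rw [hθ, div_pow]
  have habs : ∀ x : ℤ, |θ * (x : ℝ)| = θ * (x.natAbs : ℝ) := by
    intro x
    rw [abs_mul, abs_of_pos hθ0, Nat.cast_natAbs, Int.cast_abs]
  have hM := isMarkov_G.pow s
  obtain ⟨r, hr⟩ := Nat.exists_eq_add_of_le hy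
  set W : ℝ := (G ^ s) (fun L => (7 / 6 : ℝ) ^ (gap i j L).natAbs) y with hW
  have h1 : R s (fun L => clip θ (gap i j L)) y ≤ -1 + (36 * θ ^ 2 * ((7 / 6) ^ r)⁻¹) * W := by
    rw [R_apply, hW, ← hM.affine]
    refine hM.mono _ _ (fun L => ?_) y
    simp only [gap_sub, ← hd]
    set x := gap i j L
    -- the amount by which the error exceeds what is needed to stay beyond the half period
    have h2 := clip_le_sq (θ := θ) (d := x - d) (u := θ * ((x.natAbs - r : ℕ) : ℝ))
      (by
        rw [habs, ← hθD, ← mul_sub]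
        gcongr
        have : D ≤ (x - d).natAbs + (x.natAbs - r) := by omega
        have : (D : ℝ) ≤ (x - d).natAbs + (x.natAbs - r : ℕ) := by exact_mod_cast this
        linarith)
    have h3 := sq_le_exp (x.natAbs - r)
    have h4 : ((x.natAbs - r : ℕ) : ℝ) ^ 2 ≤ 72 * (((7 / 6) ^ r)⁻¹ * (7 / 6) ^ x.natAbs) := by
      rcases le_total r x.natAbs with h | h
      · rwa [mul_comm ((7 / 6 : ℝ) ^ r)⁻¹, ← pow_sub₀ _ (by norm_num) h]
      · rw [Nat.sub_eq_zero_of_le h]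
        norm_num
    have h5 := mul_le_mul_of_nonneg_left h4 (sq_nonneg θ)
    rw [mul_pow] at h2
    linarith
  have h2 : ((7 / 6 : ℝ) ^ r)⁻¹ * W ≤ 85 := by
    have h3 := G_pow_exp_le hij s y
    rw [← hW, ← hd, hr, pow_add] at h3
    have h4 := decay_le hs (le_refl D)
    have h5 : (3 / 5 : ℝ) ^ D ≤ 1 := pow_le_one₀ (by norm_num) (by norm_num)
    have h6 : (1 : ℝ) ≤ (7 / 6) ^ r := one_le_pow₀ (by norm_num)
    rw [inv_mul_le_iff₀ (by positivity)]
    nlinarith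
  have h3 : clip θ d = -1 := clip_of_ge (by
    rw [habs, ← hθD]
    gcongr)
  rw [h3]
  refine h1.trans ?_
  have h4 : 36 * θ ^ 2 * ((7 / 6) ^ r)⁻¹ * W ≤ 3060 * θ ^ 2 := by
    have := mul_le_mul_of_nonneg_left h2 (show 0 ≤ 36 * θ ^ 2 by positivity)
    linarith
  have h5 : 3060 * θ ^ 2 ≤ 30600 / D ^ 2 := by
    rw [hθ2, ← mul_div_assoc]
    gcongr
    linarith [pi_sq_lt_ten]
  linarith

lemma R_clip_le {i j : Fin 4} (hij : i ≠ j) {D s : ℕ} (hD : 1 ≤ D) (hs : 50 * D ≤ s)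
    (y : Loads) :
    R s (fun L => clip (Real.pi / D) (gap i j L)) y
      ≤ clip (Real.pi / D) (gap i j y) + (3 / 5) ^ D + drift D (gap i j y) := by
  rcases le_total (gap i j y).natAbs D with h | h
  · exact R_clip_le_of_le hij hD hs y h
  · rcases h.eq_or_lt with h' | h'
    · exact R_clip_le_of_le hij hD hs y h'.ge
    · rw [drift, if_neg (by omega)]
      have := R_clip_le_of_ge hij hD hs y h
      have : (0 : ℝ) ≤ (3 / 5) ^ D := by positivity
      linarith

/-- The indicator function of an event. -/
noncomputable def ind (p : Loads → Prop) (y : Loads) : ℝ := open Classical in if p y then 1 else 0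

lemma ind_nonneg (p : Loads → Prop) (y : Loads) : 0 ≤ ind p y := by
  unfold ind; positivity

lemma ind_of {p : Loads → Prop} {y : Loads} (h : p y) : ind p y = 1 := if_pos h

lemma ind_of_not {p : Loads → Prop} {y : Loads} (h : ¬ p y) : ind p y = 0 := if_neg h

/-- Within quadratically many rounds, the difference of two loads reaches linear size with
probability bounded away from `0`: otherwise the bounded potential would fall too far. -/
lemma exists_round_gap {i j : Fin 4} (hij : i ≠ j) {D s : ℕ} (hD : 1 ≤ D) (hs : 50 * D ≤ s)
    (hdecay : (3 / 5 : ℝ) ^ D ≤ 1 / (24 * D ^ 2)) :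
    ∃ t < 97 * D ^ 2, 1 / 1500000 ≤ (R s ^ t) (ind fun y => D < 3 * (gap i j y).natAbs) 0 := by
  by_contra! hcon
  set p : Loads → Prop := fun y => D < 3 * (gap i j y).natAbs with hp
  set K : ℕ → ℝ := fun t => (R s ^ t) (fun y => clip (Real.pi / D) (gap i j y)) 0 with hK
  have hD0 : (0 : ℝ) < D := by exact_mod_cast hD
  have hstep : ∀ t < 97 * D ^ 2, K (t + 1) ≤ K t - 1 / (48 * D ^ 2) := by
    intro t ht
    have hM := (isMarkov_R s).pow t
    have h1 : K (t + 1) ≤ (R s ^ t) ((fun y => clip (Real.pi / D) (gap i j y))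
        + fun y => (-1 / (24 * D ^ 2)) + 30601 / D ^ 2 * ind p y) 0 := by
      rw [hK]
      simp only
      rw [pow_succ, Module.End.mul_apply]
      refine hM.mono _ _ (fun y => (R_clip_le hij hD hs y).trans ?_) 0
      simp only [Pi.add_apply, drift]
      have e : -1 / (24 * (D : ℝ) ^ 2) = 1 / (24 * D ^ 2) + -1 / (12 * D ^ 2) := by
        field_simp; norm_num
      by_cases h : p y
      · rw [ind_of h, if_neg (by simpa [hp] using h)]
        have : 1 / (24 * (D : ℝ) ^ 2) + 30600 / D ^ 2
            ≤ -1 / (24 * D ^ 2) + 30601 / D ^ 2 * 1 := by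
          field_simp; norm_num
        linarith
      · rw [ind_of_not h, if_pos (by simpa [hp] using h)]
        linarith
    rw [map_add, Pi.add_apply, hM.affine] at h1
    have h2 := mul_le_mul_of_nonneg_left (hcon t ht).le (show 0 ≤ 30601 / (D : ℝ) ^ 2 by positivity)
    have h3 : -1 / (24 * (D : ℝ) ^ 2) + 30601 / D ^ 2 * (1 / 1500000) ≤ - (1 / (48 * D ^ 2)) := by
      field_simp; norm_num
    simp only [hK] at h1 ⊢
    linarith
  have hsum : ∀ t ≤ 97 * D ^ 2, K t ≤ 1 - t * (1 / (48 * D ^ 2)) := by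
    intro t ht
    induction t with
    | zero => simpa [hK] using (abs_le.1 (abs_clip_le _ _)).2
    | succ t ih =>
      have := ih (by omega)
      have := hstep t (by omega)
      push_cast
      linarith
  have h1 := hsum _ le_rfl
  have h2 : -1 ≤ K (97 * D ^ 2) := by
    have hM := (isMarkov_R s).pow (97 * D ^ 2)
    have := hM.mono (fun _ => -1) (fun y => clip (Real.pi / D) (gap i j y))
      (fun y => (abs_le.1 (abs_clip_le _ _)).1) 0
    rwa [hM.const] at this
  have h3 : ((97 * D ^ 2 : ℕ) : ℝ) * (1 / (48 * D ^ 2)) = 97 / 48 := by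
    push_cast; field_simp
  rw [h3] at h1
  linarith

/-! ### A biased random walk -/

/-- The expectation of `g` after `n` steps of the centred random walk on the line that moves by
`1 - r` with probability `r` and by `-r` with probability `1 - r`. -/
noncomputable def walk (r : ℝ) : ℕ → (ℝ → ℝ) → ℝ
  | 0, g => g 0
  | n + 1, g => r * walk r n (fun x => g (x + 1 - r)) + (1 - r) * walk r n (fun x => g (x - r))

lemma walk_mono {r : ℝ} (h0 : 0 ≤ r) (h1 : r ≤ 1) (n : ℕ) {f g : ℝ → ℝ} (h : ∀ x, f x ≤ g x) :
    walk r n f ≤ walk r n g := by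
  induction n generalizing f g with
  | zero => exact h 0
  | succ n ih =>
    have h2 : 0 ≤ 1 - r := sub_nonneg.2 h1
    unfold walk
    gcongr
    · exact ih fun x => h _
    · exact ih fun x => h _

/-- The moments of the walk up to the fourth. -/
lemma walk_poly (r : ℝ) (n : ℕ) (a b c d e : ℝ) :
    walk r n (fun x => a + b * x + c * x ^ 2 + d * x ^ 3 + e * x ^ 4)
      = a + c * (n * (r * (1 - r))) + d * (n * (r * (1 - r) * (1 - 2 * r)))
        + e * (3 * (r * (1 - r)) ^ 2 * (n * (n - 1)) + n * (r * (1 - r) * (1 - 3 * (r * (1 - r)))))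
      := by
  induction n generalizing a b c d e with
  | zero => simp [walk]
  | succ n ih =>
    have h : ∀ t : ℝ, (fun x : ℝ => a + b * (x + t) + c * (x + t) ^ 2 + d * (x + t) ^ 3
          + e * (x + t) ^ 4)
        = fun x => (a + b * t + c * t ^ 2 + d * t ^ 3 + e * t ^ 4)
          + (b + 2 * c * t + 3 * d * t ^ 2 + 4 * e * t ^ 3) * x
          + (c + 3 * d * t + 6 * e * t ^ 2) * x ^ 2 + (d + 4 * e * t) * x ^ 3 + e * x ^ 4 := by
      intro t; ext x; ring
    unfold walk
    simp only [sub_eq_add_neg _ r, add_assoc _ (1 : ℝ) (-r)]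
    rw [h, h, ih, ih]
    push_cast
    ring

/-- A polynomial minorant of the indicator function of a tail, whose expectation is positive. -/
lemma poly_le_tail (s : ℝ) {C : ℝ} (hC : 0 ≤ C) :
    (4 / 9) * ((s ^ 2 - 4 / 27 * s ^ 4 - s) / 2 - C - s ^ 2 / 9)
      ≤ open Classical in if s ≤ -C then 1 else 0 := by
  -- `4 / 27` is the least constant, with a double zero at `|s| = 3 / 2`
  have h1 : s ^ 2 - 4 / 27 * s ^ 4 ≤ |s| := by
    have h : 0 ≤ |s| * ((2 * |s| - 3) ^ 2 * (|s| + 3)) := by positivity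
    have h4 : s ^ 4 = |s| ^ 4 := ((Even.pow_abs (by decide) s)).symm
    rw [h4, ← sq_abs s]
    nlinarith
  split_ifs with h
  · rw [abs_of_nonpos (by linarith)] at h1
    nlinarith [sq_nonneg (s + 9 / 2)]
  · rcases le_total 0 s with h0 | h0
    · rw [abs_of_nonneg h0] at h1
      nlinarith [sq_nonneg s]
    · rw [abs_of_nonpos h0] at h1
      nlinarith [sq_nonneg s]

/-- Both tails of the walk, at distances of the order of the standard deviation, have probability
bounded away from `0`: `ε = 1` for the lower tail, `ε = -1` for the upper tail. -/
lemma le_walk_tail {r ε : ℝ} (h0 : 0 ≤ r) (h1 : r ≤ 1) (hr : 5 / 36 ≤ r * (1 - r))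
    (hε : ε = 1 ∨ ε = -1) {n : ℕ} (hn : n ≠ 0) :
    1 / 120 ≤ walk r n (fun x => open Classical in if ε * x ≤ -(√n / 100) then 1 else 0) := by
  have hn1 : (1 : ℝ) ≤ n := by exact_mod_cast Nat.one_le_iff_ne_zero.2 hn
  set u : ℝ := √n with hu
  have hu0 : 0 < u := Real.sqrt_pos.2 (by linarith)
  have hu2 : u ^ 2 = n := Real.sq_sqrt (by linarith)
  have hε2 : ε ^ 2 = 1 := by rcases hε with rfl | rfl <;> norm_num
  -- the minorant at `ε * x / √n`, expanded; the linear part has mean `0`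
  have key : walk r n (fun x => (-(4 / 900)) + (-(4 / 18) * ε / u) * x
      + (4 / 9 * (1 / 2 - 1 / 9) / u ^ 2) * x ^ 2 + 0 * x ^ 3
      + (-(4 / 9 * (2 / 27)) / u ^ 4) * x ^ 4)
      ≤ walk r n (fun x => open Classical in if ε * x ≤ -(u / 100) then 1 else 0) := by
    refine walk_mono h0 h1 n fun x => ?_
    have h := poly_le_tail (ε * x / u) (C := 1 / 100) (by norm_num)
    have e2 : (ε * x / u) ^ 2 = x ^ 2 / u ^ 2 := by rw [div_pow, mul_pow, hε2, one_mul]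
    have e4 : (ε * x / u) ^ 4 = x ^ 4 / u ^ 4 := by
      rw [div_pow, mul_pow, show ε ^ 4 = (ε ^ 2) ^ 2 by ring, hε2]; ring
    have e5 : (ε * x / u ≤ -(1 / 100)) ↔ ε * x ≤ -(u / 100) := by
      rw [div_le_iff₀ hu0]
      constructor <;> intro h <;> linarith
    simp only [e5] at h
    refine le_trans (le_of_eq ?_) h
    rw [e2, e4]
    ring
  refine le_trans ?_ key
  rw [walk_poly]
  set σ : ℝ := r * (1 - r) with hσ
  have hσ4 : σ ≤ 1 / 4 := by nlinarith [sq_nonneg (r - 1 / 2)]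
  have hu4 : u ^ 4 = (n : ℝ) ^ 2 := by rw [← hu2]; ring
  rw [hu2, hu4]
  have hn0 : (0 : ℝ) < n := by linarith
  have e1 : 4 / 9 * (1 / 2 - 1 / 9) / (n : ℝ) * (n * σ) = 14 / 81 * σ := by
    field_simp; norm_num
  have e2 : (3 * σ ^ 2 * (n * (n - 1)) + n * (σ * (1 - 3 * σ))) / (n : ℝ) ^ 2 ≤ 7 / 4 * σ := by
    rw [div_le_iff₀ (by positivity)]
    have h3 : 3 * σ ^ 2 * (n * (n - 1)) ≤ 3 / 4 * σ * (n * (n - 1)) := by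
      have : 3 * σ ^ 2 ≤ 3 / 4 * σ := by nlinarith
      exact mul_le_mul_of_nonneg_right this (mul_nonneg hn0.le (by linarith))
    have h4 : n * (σ * (1 - 3 * σ)) ≤ n * σ := by
      have : σ * (1 - 3 * σ) ≤ σ := by nlinarith
      exact mul_le_mul_of_nonneg_left this hn0.le
    have h5 : n * σ ≤ n ^ 2 * σ := by nlinarith [mul_nonneg hn0.le (show 0 ≤ σ by linarith)]
    nlinarith
  have e3 : -(4 / 9 * (2 / 27)) / (n : ℝ) ^ 2
        * (3 * σ ^ 2 * (n * (n - 1)) + n * (σ * (1 - 3 * σ)))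
      = -(8 / 243) * ((3 * σ ^ 2 * (n * (n - 1)) + n * (σ * (1 - 3 * σ))) / (n : ℝ) ^ 2) := by
    ring
  rw [e1, e3]
  nlinarith

/-! ### The balls in a set of lightly loaded bins -/

/-- The number of balls in the bins of `B`. -/
def total (B : Finset (Fin 4)) (y : Loads) : ℤ := ∑ b ∈ B, y b

/-- Every bin of `B` holds at least `w` balls less than every bin outside `B`. -/
def Split (B : Finset (Fin 4)) (w : ℕ) (y : Loads) : Prop := ∀ b ∈ B, ∀ a ∉ B, y b + w ≤ y a

lemma total_bump (B : Finset (Fin 4)) (y : Loads) (b : Fin 4) :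
    total B (bump y b) = total B y + if b ∈ B then 1 else 0 := by
  simp [total, bump, sum_add_distrib, Pi.single_apply]

lemma Split.bump {B : Finset (Fin 4)} {w : ℕ} {y : Loads} (h : Split B (w + 1) y) (b : Fin 4) :
    Split B w (bump y b) := by
  intro i hi a ha
  have := h i hi a ha
  have hia : i ≠ a := by rintro rfl; exact ha hi
  simp only [TwoChoice.bump, Pi.add_apply, Pi.single_apply]
  push_cast at this
  split_ifs <;> omega

lemma Split.mono {B : Finset (Fin 4)} {w w' : ℕ} {y : Loads} (h : Split B w y) (hw : w' ≤ w) :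
    Split B w' y := by
  intro i hi a ha
  have := h i hi a ha
  omega

lemma sum_prob_mul_ite (y : Loads) (B : Finset (Fin 4)) (u v : ℝ) :
    ∑ b, prob y b * (if b ∈ B then u else v)
      = (∑ b ∈ B, prob y b) * u + (1 - ∑ b ∈ B, prob y b) * v := by
  rw [← sum_prob y, ← sum_add_sum_compl B (fun b => prob y b),
    ← sum_add_sum_compl B (fun b => prob y b * (if b ∈ B then u else v)), add_sub_cancel_left,
    sum_mul, sum_mul]
  congr 1
  · exact sum_congr rfl fun b hb => by rw [if_pos hb]
  · exact sum_congr rfl fun b hb => by rw [if_neg (mem_compl.1 hb)]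

lemma total_step (B : Finset (Fin 4)) (y : Loads) (b : Fin 4) (r : ℝ) (n : ℕ) (g : ℝ → ℝ) :
    (fun L => g (total B L - total B y - r * (n + 1 : ℕ)))
      = fun L => (fun x => g (x + (if b ∈ B then 1 else 0) - r))
          (total B L - total B (bump y b) - r * n) := by
  ext L
  rw [total_bump]
  push_cast
  congr 1
  ring

/-- As long as the bins of `B` are the lightest ones, they receive the balls independently of each
other, with the probability of being hit. -/
lemma G_pow_total_of_split {B : Finset (Fin 4)} {n : ℕ} {y : Loads} (h : Split B n y)
    (g : ℝ → ℝ) :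
    (G ^ n) (fun L => g (total B L - total B y - hit #B * n)) y = walk (hit #B) n g := by
  induction n generalizing y g with
  | zero => simp [walk]
  | succ n ih =>
    have h1 : ∀ b, (G ^ n) (fun L => g (total B L - total B y - hit #B * (n + 1 : ℕ))) (bump y b)
        = if b ∈ B then walk (hit #B) n (fun x => g (x + 1 - hit #B))
          else walk (hit #B) n (fun x => g (x - hit #B)) := by
      intro b
      rw [total_step B y b, ih (h.bump b) (fun x => g (x + (if b ∈ B then 1 else 0) - hit #B))]
      split_ifs
      · rfl
      · simp only [add_zero]
    rw [G_pow_succ]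
    simp only [h1]
    rw [sum_prob_mul_ite, sum_prob_eq_hit y B (fun b hb a ha => by have := h b hb a ha; omega)]
    rfl

lemma hit_nonneg (B : Finset (Fin 4)) : 0 ≤ hit #B := by
  have : #B ≤ 4 := card_le_univ B
  have : (#B : ℝ) ≤ 4 := by exact_mod_cast this
  unfold hit
  have : (0 : ℝ) ≤ 7 - #B := by linarith
  positivity

lemma hit_le_one {B : Finset (Fin 4)} (hB : #B = 1 ∨ #B = 2) : hit #B ≤ 1 := by
  rcases hB with h | h <;> rw [h] <;> norm_num [hit]

/-- In every case, the bins of `B` receive stochastically at most as many balls as they would if they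
were the lightest ones. -/
lemma walk_le_G_pow_total {B : Finset (Fin 4)} (hB : #B = 1 ∨ #B = 2) (n : ℕ) (y : Loads)
    {g : ℝ → ℝ} (hg : Antitone g) :
    walk (hit #B) n g ≤ (G ^ n) (fun L => g (total B L - total B y - hit #B * n)) y := by
  induction n generalizing y g with
  | zero => simp [walk]
  | succ n ih =>
    have h1 : ∀ b, (if b ∈ B then walk (hit #B) n (fun x => g (x + 1 - hit #B))
          else walk (hit #B) n (fun x => g (x - hit #B)))
        ≤ (G ^ n) (fun L => g (total B L - total B y - hit #B * (n + 1 : ℕ))) (bump y b) := by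
      intro b
      rw [total_step B y b]
      refine le_trans (le_of_eq ?_) (ih (bump y b) (g := fun x => g (x + (if b ∈ B then 1 else 0)
        - hit #B)) (fun x x' h => hg (by linarith)))
      split_ifs
      · rfl
      · simp only [add_zero]
    rw [G_pow_succ]
    refine le_trans ?_ (sum_le_sum fun b _ => mul_le_mul_of_nonneg_left (h1 b) (prob_nonneg y b))
    rw [sum_prob_mul_ite]
    have h2 := sum_prob_le_hit y B
    have h3 : walk (hit #B) n (fun x => g (x + 1 - hit #B))
        ≤ walk (hit #B) n (fun x => g (x - hit #B)) :=
      walk_mono (hit_nonneg B) (hit_le_one hB) n fun x => hg (by linarith)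
    simp only [walk]
    nlinarith

lemma five_le_hit {B : Finset (Fin 4)} (hB : #B = 1 ∨ #B = 2) :
    5 / 36 ≤ hit #B * (1 - hit #B) := by
  rcases hB with h | h <;> rw [h] <;> norm_num [hit]

/-! ### The last stage -/

lemma total_univ_bump (y : Loads) (b : Fin 4) : total univ (bump y b) = total univ y + 1 := by
  rw [total_bump, if_pos (mem_univ b)]

/-- Every insertion increases the number of all balls by one. -/
lemma G_pow_mono_of_total {n : ℕ} {y : Loads} {f g : Loads → ℝ}
    (h : ∀ L, total univ L = total univ y + n → f L ≤ g L) : (G ^ n) f y ≤ (G ^ n) g y := by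
  refine G_pow_mono_of_inv (fun k L => total univ L = total univ y + k)
    (fun k L b hL => ?_) f g n 0 (fun L hL => h L (by simpa using hL)) y (by simp)
  rw [total_univ_bump, hL]; push_cast; ring

/-- Some bin holds at least `x` balls. -/
def Heavy (x : ℝ) (y : Loads) : Prop := ∃ b, x ≤ (y b : ℝ)

/-- If a block of loads `y` is present, then `q` new balls, the sample, are inserted, then `n` others,
then the sample is deleted and replaced by `q` new balls. -/
noncomputable def resample (q n : ℕ) (f : Loads → ℝ) (y : Loads) : ℝ :=
  (G ^ q) (fun L₁ => (G ^ n) (fun L₂ => (G ^ q) f (L₂ - (L₁ - y))) L₁) y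

/-- If the bins of `B` hold few balls, then some other bin holds many balls. -/
lemma exists_heavy {B : Finset (Fin 4)} (hB : #B = 1 ∨ #B = 2) {y : Loads} {m : ℕ} {t : ℝ}
    (hm : total univ y = m) (h : (total B y : ℝ) ≤ #B * (m / 4 + t) - 4 * t) :
    Heavy (m / 4 + t) y := by
  by_contra hcon
  unfold Heavy at hcon
  push Not at hcon
  have h1 : total univ y = total B y + total Bᶜ y := (sum_add_sum_compl B y).symm
  have h3 : Bᶜ.Nonempty := by
    rw [← card_pos]
    have := card_add_card_compl B
    simp only [Fintype.card_fin] at this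
    omega
  have h4 : (total Bᶜ y : ℝ) < (4 - #B) * (m / 4 + t) := by
    rw [total, ← card_compl_four]
    push_cast
    rw [← nsmul_eq_mul, ← sum_const]
    exact sum_lt_sum_of_nonempty h3 fun b _ => hcon b
  have h5 : (m : ℝ) = total B y + total Bᶜ y := by
    rw [hm] at h1
    exact_mod_cast h1
  linarith

/-- The heart of the matter: if the block leaves the bins of `B` lighter than the others, then the
sample falls into `B` like independent balls, and so does, at most, its replacement. With positive
probability the former is more than average and the latter less, by the order of `√q`. So unless some
bin is heavy before the replacement, some bin is heavy afterwards. -/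
lemma le_resample_of_split {B : Finset (Fin 4)} (hB : #B = 1 ∨ #B = 2) {q n m : ℕ} (hq : q ≠ 0)
    {y : Loads} (hy : Split B q y) (hm : total univ y + q + n = m) {t : ℝ}
    (ht : 200 * t ≤ √q) :
    1 / 120 * (1 / 120 - (G ^ (q + n)) (ind (Heavy (m / 4 + t))) y)
      ≤ resample q n (ind (Heavy (m / 4 + t))) y := by
  set r := hit #B with hr
  have hr0 : 0 ≤ r := hit_nonneg B
  have hr1 : r ≤ 1 := hit_le_one hB
  set up : ℝ → ℝ := fun x => open Classical in if -1 * x ≤ -(√q / 100) then 1 else 0 with hup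
  set lo : ℝ → ℝ := fun x => open Classical in if 1 * x ≤ -(√q / 100) then 1 else 0 with hlo
  have hup' : 1 / 120 ≤ walk r q up := le_walk_tail hr0 hr1 (five_le_hit hB) (Or.inr rfl) hq
  have hlo' : 1 / 120 ≤ walk r q lo := le_walk_tail hr0 hr1 (five_le_hit hB) (Or.inl rfl) hq
  have hlo_anti : Antitone lo := by
    intro x x' h
    simp only [hlo]
    split_ifs <;> linarith
  have hMq := isMarkov_G.pow q
  have hMn := isMarkov_G.pow n
  -- `L₁`: after the sample, `L₂`: after filling up, `L₂ - (L₁ - y)`: after deleting the sample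
  have h1 : ∀ L₁ : Loads, total univ L₁ = total univ y + q → ∀ L₂ : Loads,
      total univ L₂ = total univ L₁ + n →
      1 / 120 * up (total B L₁ - total B y - r * q) + -(1 / 120) * ind (Heavy (m / 4 + t)) L₂
        ≤ (G ^ q) (ind (Heavy (m / 4 + t))) (L₂ - (L₁ - y)) := by
    intro L₁ hL₁ L₂ hL₂
    have hpos : 0 ≤ (G ^ q) (ind (Heavy (m / 4 + t))) (L₂ - (L₁ - y)) := by
      have := hMq.mono (fun _ => 0) (ind (Heavy (m / 4 + t))) (fun L => ind_nonneg _ _)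
        (L₂ - (L₁ - y))
      rwa [hMq.const] at this
    by_cases hw : Heavy (m / 4 + t) L₂
    · rw [ind_of hw]
      have : up (total B L₁ - total B y - r * q) ≤ 1 := by
        simp only [hup]; split_ifs <;> norm_num
      linarith
    rw [ind_of_not hw]
    by_cases hu : -1 * ((total B L₁ : ℝ) - total B y - r * q) ≤ -(√q / 100)
    swap
    · simp only [hup, if_neg hu]
      linarith
    simp only [hup, if_pos hu]
    set z := L₂ - (L₁ - y) with hz
    have htot : ∀ A : Finset (Fin 4), total A z = total A L₂ - (total A L₁ - total A y) := by
      intro A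
      simp [total, hz, sum_sub_distrib]
    have hBL₂ : (total B L₂ : ℝ) ≤ #B * (m / 4 + t) := by
      unfold Heavy at hw
      push Not at hw
      rw [total]
      push_cast
      rw [← nsmul_eq_mul]
      exact sum_le_card_nsmul _ _ _ fun b _ => (hw b).le
    have h2 := walk_le_G_pow_total hB q z hlo_anti
    have h3 : (G ^ q) (fun L => lo (total B L - total B z - r * q)) z
        ≤ (G ^ q) (ind (Heavy (m / 4 + t))) z := by
      refine G_pow_mono_of_total fun L hL => ?_
      simp only [hlo]
      split_ifs with hl
      · rw [ind_of]
        refine exists_heavy hB ?_ ?_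
        · rw [hL, htot]; omega
        · have := htot B
          have : (total B z : ℝ) = total B L₂ - (total B L₁ - total B y) := by exact_mod_cast this
          linarith
      · exact ind_nonneg _ _
    rw [← hr] at h2
    linarith
  have h2 : (G ^ q) (fun L₁ => 1 / 120 * up (total B L₁ - total B y - r * q)
      + -(1 / 120) * (G ^ n) (ind (Heavy (m / 4 + t))) L₁) y
      ≤ resample q n (ind (Heavy (m / 4 + t))) y := by
    refine G_pow_mono_of_total fun L₁ hL₁ => ?_
    rw [← hMn.affine]
    exact G_pow_mono_of_total fun L₂ hL₂ => h1 L₁ hL₁ L₂ hL₂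
  have h3 : (fun L₁ => 1 / 120 * up (total B L₁ - total B y - r * q)
      + -(1 / 120) * (G ^ n) (ind (Heavy (m / 4 + t))) L₁)
      = (1 / 120 : ℝ) • (fun L₁ => up (total B L₁ - total B y - r * q))
        + (-(1 / 120) : ℝ) • ((G ^ n) (ind (Heavy (m / 4 + t)))) := by
    ext; simp
  rw [h3, map_add, map_smul, map_smul, ← Module.End.mul_apply, ← pow_add] at h2
  simp only [Pi.add_apply, Pi.smul_apply, smul_eq_mul] at h2
  rw [hr, G_pow_total_of_split hy, ← hr] at h2
  linarith

/-! ### A block that is unevenly distributed -/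

/-- If two loads differ much, then some gap between successive loads is large, and the bins below
this gap are split from the others. -/
lemma exists_split {q : ℕ} {y : Loads} {i j : Fin 4} (h : y i + 6 * q < y j) :
    ∃ B : Finset (Fin 4), (#B = 1 ∨ #B = 2 ∨ #B = 3) ∧ Split B (2 * q) y := by
  by_contra! hcon
  -- above every level from `y i` to `y j` there is another load within distance `2 * q`
  have key : ∀ c, y i ≤ c → c < y j → ∃ a, c < y a ∧ y a < c + 2 * q := by
    intro c hi hj
    have h1 : 0 < #(univ.filter fun b => y b ≤ c) :=
      card_pos.2 ⟨i, by simpa using hi⟩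
    have h2 : #(univ.filter fun b => y b ≤ c) < 4 := by
      have := card_lt_card (filter_ssubset.2 ⟨j, mem_univ j, not_le.2 hj⟩ :
        (univ.filter fun b => y b ≤ c) ⊂ univ)
      simpa using this
    have h3 := hcon (univ.filter fun b => y b ≤ c) (by omega)
    unfold Split at h3
    push Not at h3
    obtain ⟨b, hb, a, ha, hab⟩ := h3
    simp only [mem_filter, mem_univ, true_and] at hb ha
    push_cast at hab
    exact ⟨a, by omega, by omega⟩
  obtain ⟨a, h1, h1'⟩ := key (y i) le_rfl (by omega)
  obtain ⟨b, h2, h2'⟩ := key (y a) (by omega) (by omega)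
  obtain ⟨c, h3, h3'⟩ := key (y b) (by omega) (by omega)
  -- five distinct loads in four bins
  have hinj : Function.Injective ![i, a, b, c, j] := by
    apply Function.Injective.of_comp (f := y)
    apply StrictMono.injective
    rw [Fin.strictMono_iff_lt_succ]
    intro k
    fin_cases k
    · exact h1
    · exact h2
    · exact h3
    · change y c < y j
      omega
  simpa using Fintype.card_le_of_injective _ hinj

/-- The loads of a block of `s` balls that leaves one or two bins lighter than the others. -/
def Good (q s : ℕ) (y : Loads) : Prop :=
  total univ y = s ∧ ∃ B : Finset (Fin 4), (#B = 1 ∨ #B = 2) ∧ Split B q y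

/-- The loads of a block that leaves three bins lighter than the fourth. -/
def Top (q : ℕ) (y : Loads) : Prop := ∃ a : Fin 4, Split {a}ᶜ (2 * q) y

lemma R_mono_of_total {s : ℕ} {f g : Loads → ℝ} (h : ∀ y, total univ y = s → f y ≤ g y) :
    R s f ≤ R s g := by
  intro y
  rw [R_apply, R_apply]
  refine G_pow_mono_of_total fun L hL => h _ ?_
  have : total univ (L - y) = total univ L - total univ y := by simp [total, sum_sub_distrib]
  omega

/-- A round reverses the differences of loads. So a bin that is heavier than all others becomes
lighter than all others. -/
lemma half_le_R_good {D s q : ℕ} (hs : 50 * D ≤ s) (hqD : q ≤ D)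
    (hD : (3 / 5 : ℝ) ^ D ≤ 1 / 12) (hq : 84 * (6 / 7 : ℝ) ^ q ≤ 1 / 12) {y : Loads}
    (hy : Top q y) : 1 / 2 ≤ R s (ind (Good q s)) y := by
  obtain ⟨a, ha⟩ := hy
  have hM := isMarkov_G.pow s
  have hgap : ∀ c, c ≠ a → (2 * q : ℤ) ≤ gap a c y := by
    intro c hc
    have := ha c (by simpa using hc) a (by simp)
    unfold gap
    push_cast at this
    omega
  set e : Fin 4 → ℕ := fun c => (gap a c y).natAbs - q with he
  -- at least the number of bins whose difference to `a` is not reversed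
  set F : Loads → ℝ := ∑ c ∈ ({a} : Finset (Fin 4))ᶜ,
    (((7 / 6 : ℝ) ^ e c)⁻¹) • (fun L => (7 / 6 : ℝ) ^ (gap a c L).natAbs) with hF
  have hterm : ∀ c ∈ ({a} : Finset (Fin 4))ᶜ,
      ((7 / 6 : ℝ) ^ e c)⁻¹ * (G ^ s) (fun L => (7 / 6 : ℝ) ^ (gap a c L).natAbs) y ≤ 1 / 6 := by
    intro c hc
    have hca : c ≠ a := by simpa using hc
    have h1 := G_pow_exp_le hca.symm s y
    have h2 := hgap c hca
    have h3 : (gap a c y).natAbs = e c + q := by simp only [he]; omega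
    have h4 : q ≤ e c := by simp only [he]; omega
    have h5 := (decay_le hs hqD).trans hD
    have h6 : (1 : ℝ) / 12 * (7 / 6) ^ e c ≥ 84 := by
      have h7 : (7 / 6 : ℝ) ^ q ≤ (7 / 6) ^ e c := pow_le_pow_right₀ (by norm_num) h4
      have h8 : (6 / 7 : ℝ) ^ q * (7 / 6) ^ q = 1 := by rw [← mul_pow]; norm_num
      have h9 := mul_le_mul_of_nonneg_right hq (show (0 : ℝ) ≤ (7 / 6) ^ q by positivity)
      rw [mul_assoc, h8] at h9
      linarith
    rw [inv_mul_le_iff₀ (by positivity)]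
    rw [h3, pow_add] at h1
    have h7 := mul_le_mul_of_nonneg_left h5 (show (0 : ℝ) ≤ (7 / 6) ^ e c by positivity)
    linarith
  have hFle : (G ^ s) F y ≤ 1 / 2 := by
    rw [hF, map_sum, Finset.sum_apply]
    simp only [map_smul, Pi.smul_apply, smul_eq_mul]
    refine (sum_le_card_nsmul _ _ _ hterm).trans (le_of_eq ?_)
    rw [nsmul_eq_mul, card_compl_four]
    norm_num
  have hle : (G ^ s) (fun L => 1 + -1 * F L) y ≤ R s (ind (Good q s)) y := by
    rw [R_apply]
    refine G_pow_mono_of_total fun L hL => ?_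
    have hFL : F L = ∑ c ∈ ({a} : Finset (Fin 4))ᶜ,
        ((7 / 6 : ℝ) ^ e c)⁻¹ * (7 / 6 : ℝ) ^ (gap a c L).natAbs := by
      simp [hF, Finset.sum_apply]
    by_cases hsplit : Split {a} q (L - y)
    · rw [ind_of]
      · have : 0 ≤ F L := by rw [hFL]; positivity
        linarith
      · refine ⟨?_, {a}, Or.inl (card_singleton a), hsplit⟩
        have : total univ (L - y) = total univ L - total univ y := by
          simp [total, sum_sub_distrib]
        omega
    · refine le_trans ?_ (ind_nonneg _ _)
      unfold Split at hsplit
      push Not at hsplit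
      obtain ⟨b, hb, c, hc, hbc⟩ := hsplit
      rw [mem_singleton] at hb hc
      subst hb
      have h1 := hgap c hc
      have h2 : e c ≤ (gap b c L).natAbs := by
        have h3 : gap b c L = L b - L c := rfl
        have h4 : gap b c y = y b - y c := rfl
        simp only [Pi.sub_apply] at hbc
        simp only [he]
        omega
      have h3 : 1 ≤ F L := by
        rw [hFL]
        refine le_trans ?_ (single_le_sum (f := fun c => ((7 / 6 : ℝ) ^ e c)⁻¹
          * (7 / 6 : ℝ) ^ (gap b c L).natAbs) (fun c _ => by positivity)
          (mem_compl.2 (by simpa using hc)))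
        rw [le_inv_mul_iff₀ (by positivity), mul_one]
        exact pow_le_pow_right₀ (by norm_num) h2
      linarith
  rw [hM.affine] at hle
  linarith

/-- After some quadratically bounded number of rounds, the block present is unevenly distributed with
probability bounded away from `0`. -/
lemma exists_round_good {D s q : ℕ} (hq1 : 18 * q ≤ D) (hD1 : 1 ≤ D) (hs : 50 * D ≤ s)
    (hdecay : (3 / 5 : ℝ) ^ D ≤ 1 / (24 * D ^ 2)) (hq : 84 * (6 / 7 : ℝ) ^ q ≤ 1 / 12) :
    ∃ t ≤ 97 * D ^ 2, 1 / 6000000 ≤ (R s ^ t) (ind (Good q s)) 0 := by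
  obtain ⟨t, ht, h⟩ := exists_round_gap (i := 0) (j := 1) (by decide) hD1 hs hdecay
  set p : Loads → Prop := fun y => D < 3 * (gap 0 1 y).natAbs with hp
  have hD12 : (3 / 5 : ℝ) ^ D ≤ 1 / 12 := by
    refine hdecay.trans ?_
    have : (1 : ℝ) ≤ D := by exact_mod_cast hD1
    gcongr
    nlinarith
  -- before the first round all loads are `0`
  obtain ⟨u, rfl⟩ : ∃ u, t = u + 1 := by
    refine Nat.exists_eq_succ_of_ne_zero ?_
    rintro rfl
    rw [pow_zero, Module.End.one_apply, ind_of_not (by simp [hp, gap])] at h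
    norm_num at h
  have hM := (isMarkov_R s).pow u
  have h1 : R s (ind p) ≤ R s (ind (Good q s) + ind (Top q)) := by
    refine R_mono_of_total fun y hy => ?_
    have hg := ind_nonneg (Good q s) y
    have ht := ind_nonneg (Top q) y
    simp only [Pi.add_apply]
    by_cases hpy : p y
    swap
    · rw [ind_of_not hpy]; linarith
    obtain ⟨B, hB, hsplit⟩ : ∃ B : Finset (Fin 4), (#B = 1 ∨ #B = 2 ∨ #B = 3)
        ∧ Split B (2 * q) y := by
      simp only [hp, gap] at hpy
      rcases le_total (y 0) (y 1) with h0 | h0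
      · exact exists_split (i := 0) (j := 1) (by omega)
      · exact exists_split (i := 1) (j := 0) (by omega)
    rw [ind_of hpy]
    rcases or_assoc.2 hB with hB | hB
    · rw [ind_of (p := Good q s) ⟨hy, B, hB, hsplit.mono (by omega)⟩]; linarith
    · have h4 : #Bᶜ = 1 := by
        have := card_add_card_compl B
        simp only [Fintype.card_fin] at this
        omega
      obtain ⟨a, ha⟩ := card_eq_one.1 h4
      rw [ind_of (p := Top q) ⟨a, by rwa [← ha, compl_compl]⟩]; linarith
  have h2 : ind (Top q) ≤ (2 : ℝ) • R s (ind (Good q s)) := by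
    intro y
    simp only [Pi.smul_apply, smul_eq_mul]
    by_cases hy : Top q y
    · rw [ind_of hy]
      have := half_le_R_good hs (by omega) hD12 hq hy
      linarith
    · rw [ind_of_not hy]
      have h3 := (isMarkov_R s).mono (fun _ => 0) (ind (Good q s)) (fun _ => ind_nonneg _ _) y
      rw [(isMarkov_R s).const] at h3
      linarith
  have h3 : (R s ^ (u + 1)) (ind p) 0
      ≤ (R s ^ (u + 1)) (ind (Good q s)) 0 + 2 * (R s ^ (u + 2)) (ind (Good q s)) 0 := by
    rw [pow_succ (R s) (u + 1), pow_succ, Module.End.mul_apply, Module.End.mul_apply,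
      Module.End.mul_apply, Module.End.mul_apply]
    refine (hM.mono _ _ h1 0).trans ?_
    have h4 := hM.mono _ _ ((isMarkov_R s).mono _ _ h2) 0
    rw [map_smul, map_smul] at h4
    rw [map_add, map_add, Pi.add_apply]
    simpa using h4
  by_contra! hcon
  have h4 := hcon (u + 1) ht.le
  have h5 := hcon (u + 2) (by omega)
  linarith

open Filter in
/-- For large `m`, the exponentially small errors are negligible. Throughout, `m / 100` is the scale of
the differences of loads that are reached, and `m / 1800` is the size of the sample. -/
lemma eventually_decay : ∀ᶠ m : ℕ in atTop, 1800 ≤ m ∧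
    (3 / 5 : ℝ) ^ (m / 100) ≤ 1 / (24 * (m / 100 : ℕ) ^ 2) ∧
    84 * (6 / 7 : ℝ) ^ (m / 1800) ≤ 1 / 12 := by
  have hdiv : ∀ k : ℕ, k ≠ 0 → Tendsto (fun m : ℕ => m / k) atTop atTop :=
    fun k hk => Nat.tendsto_div_const_atTop hk
  have h1 := (tendsto_pow_const_mul_const_pow_of_lt_one 2 (r := (3 / 5 : ℝ)) (by norm_num)
    (by norm_num)).comp (hdiv 100 (by norm_num))
  have h2 := ((tendsto_pow_atTop_nhds_zero_of_lt_one (r := (6 / 7 : ℝ)) (by norm_num)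
    (by norm_num)).const_mul 84).comp (hdiv 1800 (by norm_num))
  rw [mul_zero] at h2
  filter_upwards [eventually_ge_atTop 1800,
    h1.eventually (ge_mem_nhds (show (0 : ℝ) < 1 / 24 by norm_num)),
    h2.eventually (ge_mem_nhds (show (0 : ℝ) < 1 / 12 by norm_num))] with m hm h1 h2
  refine ⟨hm, ?_, h2⟩
  have hD : (0 : ℝ) < (m / 100 : ℕ) := by
    have : 0 < m / 100 := by omega
    exact_mod_cast this
  simp only [Function.comp_apply] at h1
  rw [le_div_iff₀ (by positivity)]
  linarith

open Filter in
/-- After suitably many rounds, either filling up the bins or filling up and resampling leads to a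
heavy bin, with probability bounded away from `0`. -/
lemma exists_heavy_round : ∀ᶠ m : ℕ in atTop, ∃ t ≤ 97 * (m / 100) ^ 2,
    1 / 200000000000 ≤ (R (m / 2) ^ t) ((G ^ (m - m / 2)) (ind (Heavy (m / 4 + 1 / 12000 * √m)))) 0
    ∨ 1 / 200000000000 ≤ (R (m / 2) ^ t) (resample (m / 1800) (m - m / 2 - m / 1800)
        (ind (Heavy (m / 4 + 1 / 12000 * √m)))) 0 := by
  filter_upwards [eventually_decay] with m ⟨hm, hD, hq⟩
  obtain ⟨t, ht, h⟩ := exists_round_good (D := m / 100) (s := m / 2) (q := m / 1800) (by omega)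
    (by omega) (by omega) hD hq
  refine ⟨t, ht, ?_⟩
  set q := m / 1800 with hqdef
  set n := m - m / 2 - q with hn
  set f := ind (Heavy (m / 4 + 1 / 12000 * √m)) with hf
  have hM := (isMarkov_R (m / 2)).pow t
  have hsqrt : 200 * (1 / 12000 * √m) ≤ √q := by
    have h1 : (m : ℝ) ≤ 3600 * q := by
      have : m ≤ 3600 * q := by omega
      exact_mod_cast this
    have h2 : √(m : ℝ) ≤ 60 * √q := by
      rw [show (60 : ℝ) = √3600 by
        rw [show (3600 : ℝ) = 60 ^ 2 by norm_num, Real.sqrt_sq (by norm_num)],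
        ← Real.sqrt_mul (by norm_num)]
      exact Real.sqrt_le_sqrt h1
    linarith
  have e : q + n = m - m / 2 := by omega
  have hpoint : (1 / 14400 : ℝ) • ind (Good q (m / 2)) + (-(1 / 120) : ℝ) • (G ^ (m - m / 2)) f
      ≤ resample q n f := by
    intro y
    simp only [Pi.add_apply, Pi.smul_apply, smul_eq_mul]
    by_cases hy : Good q (m / 2) y
    · rw [ind_of hy]
      obtain ⟨hs, B, hB, hsplit⟩ := hy
      have := le_resample_of_split hB (q := q) (n := n) (m := m) (by omega) hsplit
        (by rw [hs]; omega) hsqrt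
      rw [e] at this
      linarith
    · rw [ind_of_not hy]
      have h0 : ∀ k z, 0 ≤ (G ^ k) f z := by
        intro k z
        have := (isMarkov_G.pow k).mono (fun _ => 0) f (fun _ => ind_nonneg _ _) z
        rwa [(isMarkov_G.pow k).const] at this
      have h1 := h0 (m - m / 2) y
      have h2 : 0 ≤ resample q n f y := by
        have h3 := (isMarkov_G.pow q).mono (fun _ => 0)
          (fun L₁ => (G ^ n) (fun L₂ => (G ^ q) f (L₂ - (L₁ - y))) L₁) (fun L₁ => by
            have h4 := (isMarkov_G.pow n).mono (fun _ => 0)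
              (fun L₂ => (G ^ q) f (L₂ - (L₁ - y))) (fun L₂ => h0 _ _) L₁
            rwa [(isMarkov_G.pow n).const] at h4) y
        rwa [(isMarkov_G.pow q).const] at h3
      linarith
  have h1 := hM.mono _ _ hpoint 0
  rw [map_add, map_smul, map_smul] at h1
  simp only [Pi.add_apply, Pi.smul_apply, smul_eq_mul] at h1
  by_contra! hcon
  linarith [hcon.1, hcon.2]

/-! ### From load vectors to balls -/

/-- The expectation of a function of the state after given operations. -/
noncomputable def ex : List Op → (State (Fin 4) → ℝ) → State (Fin 4) → ℝ
  | [], f, s => f s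
  | Op.insert x :: σ, f, s => (∑ h : Hash (Fin 4), ex σ f (place s x (greedy s h))) / 12
  | Op.delete x :: σ, f, s => ex σ f (fun b => (s b).erase x)

lemma ex_append (σ τ : List Op) (f : State (Fin 4) → ℝ) (s : State (Fin 4)) :
    ex (σ ++ τ) f s = ex σ (ex τ f) s := by
  induction σ generalizing s with
  | nil => rfl
  | cons o σ ih => cases o <;> simp [ex, ih]

lemma ex_nonneg (σ : List Op) {f : State (Fin 4) → ℝ} (hf : ∀ s, 0 ≤ f s) (s : State (Fin 4)) :
    0 ≤ ex σ f s := by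
  induction σ generalizing s with
  | nil => exact hf s
  | cons o σ ih =>
    cases o
    · exact div_nonneg (sum_nonneg fun h _ => ih _) (by norm_num)
    · exact ih _

lemma card_hash : Fintype.card (Hash (Fin 4)) = 12 := by decide

/-- The probability of an event is the expectation, in the elementary sense of `ex`, of its indicator
function. -/
lemma run_toOuterMeasure (σ : List Op) (A : Set (State (Fin 4))) (s : State (Fin 4)) :
    (run greedy σ s).toOuterMeasure A = ENNReal.ofReal (ex σ (A.indicator 1) s) := by
  have hA : ∀ s, 0 ≤ A.indicator (1 : State (Fin 4) → ℝ) s :=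
    fun s => Set.indicator_nonneg (fun _ _ => zero_le_one) s
  induction σ generalizing s with
  | nil =>
    rw [run, PMF.toOuterMeasure_pure_apply, ex]
    by_cases h : s ∈ A <;> simp [h]
  | cons o σ ih =>
    cases o with
    | insert x =>
      rw [run, step, PMF.bind_map, PMF.toOuterMeasure_bind_apply, tsum_fintype, ex, sum_div,
        ENNReal.ofReal_sum_of_nonneg fun h _ => div_nonneg (ex_nonneg σ hA _) (by norm_num)]
      refine sum_congr rfl fun h _ => ?_
      rw [PMF.uniformOfFintype_apply, card_hash, Function.comp_apply, ih,
        ENNReal.ofReal_div_of_pos (by norm_num), mul_comm, ENNReal.div_eq_inv_mul, mul_comm]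
      norm_num
    | delete x =>
      rw [run, step, PMF.pure_bind, ih, ex]

/-- The load vector of a state. -/
def loads (s : State (Fin 4)) : Loads := fun b => (load s b : ℤ)

/-- The successive insertion of the balls of a list. -/
def inserts (xs : List ℕ) : List Op := xs.map Op.insert

/-- The successive deletion of the balls of a list. -/
def deletes (xs : List ℕ) : List Op := xs.map Op.delete

lemma loads_place {s : State (Fin 4)} {x : ℕ} {b : Fin 4} (hx : x ∉ s b) :
    loads (place s x b) = bump (loads s) b := by
  ext k
  by_cases h : k = b
  · subst h
    simp [loads, load, place, bump, hx]
  · simp [loads, load, place, bump, h]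

lemma greedy_eq (s : State (Fin 4)) (h : Hash (Fin 4)) :
    greedy s h = if loads s h.1.1 ≤ loads s h.1.2 then h.1.1 else h.1.2 := by
  simp [greedy, loads]

lemma place_subset {s : State (Fin 4)} {P : Finset ℕ} (hs : ∀ b, s b ⊆ P) (x : ℕ) (c b : Fin 4) :
    place s x c b ⊆ insert x P := by
  unfold place
  by_cases h : b = c
  · subst h
    rw [Function.update_self]
    exact insert_subset_insert x (hs b)
  · rw [Function.update_of_ne h]
    exact (hs b).trans (subset_insert x P)

lemma place_inter {s : State (Fin 4)} {x : ℕ} {D : Finset ℕ} (hx : x ∉ D) (c b : Fin 4) :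
    place s x c b ∩ D = s b ∩ D := by
  unfold place
  by_cases h : b = c
  · subst h
    rw [Function.update_self, insert_inter_of_notMem hx]
  · rw [Function.update_of_ne h]

/-- Inserting new balls into a state changes its load vector as described by the operator `G`, and
leaves the places of the balls of `D` unchanged. -/
lemma ex_inserts {xs : List ℕ} (hxs : xs.Nodup) {P D : Finset ℕ} (hD : D ⊆ P)
    (hP : ∀ x ∈ xs, x ∉ P) {f : State (Fin 4) → ℝ} {Φ : State (Fin 4) → Loads → ℝ}
    (hf : ∀ s : State (Fin 4), (∀ b, s b ⊆ P ∪ xs.toFinset) →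
      f s = Φ (fun b => s b ∩ D) (loads s))
    {s : State (Fin 4)} (hs : ∀ b, s b ⊆ P) :
    ex (inserts xs) f s = (G ^ xs.length) (Φ (fun b => s b ∩ D)) (loads s) := by
  induction xs generalizing P s with
  | nil => exact hf s (by simpa using hs)
  | cons x xs ih =>
    have hx : x ∉ P := hP x List.mem_cons_self
    have h1 : ∀ b, ex (inserts xs) f (place s x b)
        = (G ^ xs.length) (Φ (fun b => s b ∩ D)) (bump (loads s) b) := by
      intro b
      rw [ih (List.nodup_cons.1 hxs).2 (P := insert x P) (hD.trans (subset_insert x P)),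
        loads_place fun h => hx (hs b h)]
      · simp only [place_inter fun h => hx (hD h)]
      · intro z hz h
        rcases mem_insert.1 h with rfl | h
        · exact (List.nodup_cons.1 hxs).1 hz
        · exact hP z (List.mem_cons_of_mem x hz) h
      · intro s hs
        exact hf s fun b => (hs b).trans (by simp)
      · exact place_subset hs x b
    rw [inserts, List.map_cons, ex, List.length_cons, G_pow_succ, ← inserts]
    simp only [h1, greedy_eq]
    rw [sum_hash (loads s) (fun b => (G ^ xs.length) (Φ (fun b => s b ∩ D)) (bump (loads s) b))]
    ring

lemma ex_deletes (ds : List ℕ) (f : State (Fin 4) → ℝ) (s : State (Fin 4)) :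
    ex (deletes ds) f s = f (fun b => s b \ ds.toFinset) := by
  induction ds generalizing s with
  | nil => simp [deletes, ex]
  | cons x ds ih =>
    rw [deletes, List.map_cons, ex, ← deletes, ih]
    congr 1
    ext b z
    simp only [mem_sdiff, mem_erase, List.toFinset_cons, mem_insert]
    tauto

lemma loads_sdiff (s : State (Fin 4)) (D : Finset ℕ) :
    loads (fun b => s b \ D) = loads s - loads (fun b => s b ∩ D) := by
  ext b
  simp only [loads, load, Pi.sub_apply]
  have := card_sdiff_add_card_inter (s b) D
  omega

/-- A round on the level of balls. -/
lemma ex_round {xs ps : List ℕ} (hxs : xs.Nodup) (hps : ∀ x ∈ xs, x ∉ ps.toFinset)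
    {f : State (Fin 4) → ℝ} {τ : List Op} {φ : Loads → ℝ}
    (hτ : ∀ s : State (Fin 4), (∀ b, s b ⊆ xs.toFinset) → ex τ f s = φ (loads s))
    {s : State (Fin 4)} (hs : ∀ b, s b ⊆ ps.toFinset) :
    ex (inserts xs ++ (deletes ps ++ τ)) f s = R xs.length φ (loads s) := by
  rw [ex_append, ex_inserts hxs (Subset.refl ps.toFinset) hps
    (Φ := fun A L => φ (L - loads A)) _ hs, R_apply]
  · simp only [fun b => inter_eq_left.2 (hs b)]
  · intro s hs
    rw [ex_append, ex_deletes, hτ _ fun b => ?_, loads_sdiff]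
    intro z hz
    rcases mem_union.1 (hs b (mem_sdiff.1 hz).1) with h | h
    · exact absurd h (mem_sdiff.1 hz).2
    · exact h

/-- The operations of `t` rounds with blocks of `s` balls, followed by further operations `fin`. The
balls of the list `ps` are present, and the names from `a` on are unused. -/
def rounds (fin : List ℕ → ℕ → List Op) (s : ℕ) : ℕ → List ℕ → ℕ → List Op
  | 0, ps, a => fin ps a
  | t + 1, ps, a =>
      inserts (List.range' a s) ++ (deletes ps ++ rounds fin s t (List.range' a s) (a + s))

/-- The last operations: filling up. -/
def fill (n : ℕ) (_ : List ℕ) (a : ℕ) : List Op := inserts (List.range' a n)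

/-- The last operations: filling up and then replacing the first `q` of the new balls. -/
def fillResample (q n : ℕ) (_ : List ℕ) (a : ℕ) : List Op :=
  inserts (List.range' a q) ++ (inserts (List.range' (a + q) n) ++
    (deletes (List.range' a q) ++ inserts (List.range' (a + q + n) q)))

/-- The load vector of the current block evolves by the operator `R`. -/
lemma ex_rounds {fin : List ℕ → ℕ → List Op} {f : State (Fin 4) → ℝ} {ψ : Loads → ℝ}
    (hfin : ∀ ps a (st : State (Fin 4)), (∀ x ∈ ps, x < a) → (∀ b, st b ⊆ ps.toFinset) →
      ex (fin ps a) f st = ψ (loads st))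
    (s t : ℕ) (ps : List ℕ) (a : ℕ) (st : State (Fin 4)) (ha : ∀ x ∈ ps, x < a)
    (hst : ∀ b, st b ⊆ ps.toFinset) :
    ex (rounds fin s t ps a) f st = (R s ^ t) ψ (loads st) := by
  induction t generalizing ps a st with
  | zero => exact hfin ps a st ha hst
  | succ t ih =>
    rw [rounds, ex_round (φ := (R s ^ t) ψ) List.nodup_range' _ _ hst, List.length_range',
      pow_succ', Module.End.mul_apply]
    · intro x hx h
      have := ha x (List.mem_toFinset.1 h)
      have := (List.mem_range'_1.1 hx).1
      omega
    · intro s' hs'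
      exact ih _ _ _ (fun x hx => (List.mem_range'_1.1 hx).2) hs'

lemma ex_fill (n : ℕ) (g : Loads → ℝ) (ps : List ℕ) (a : ℕ) (st : State (Fin 4))
    (ha : ∀ x ∈ ps, x < a) (hst : ∀ b, st b ⊆ ps.toFinset) :
    ex (fill n ps a) (fun s => g (loads s)) st = (G ^ n) g (loads st) := by
  rw [fill, ex_inserts List.nodup_range' (empty_subset ps.toFinset) _
    (Φ := fun _ L => g L) (fun _ _ => rfl) hst, List.length_range']
  intro x hx h
  have := ha x (List.mem_toFinset.1 h)
  have := (List.mem_range'_1.1 hx).1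
  omega

lemma ex_fillResample (q n : ℕ) (g : Loads → ℝ) (ps : List ℕ) (a : ℕ) (st : State (Fin 4))
    (ha : ∀ x ∈ ps, x < a) (hst : ∀ b, st b ⊆ ps.toFinset) :
    ex (fillResample q n ps a) (fun s => g (loads s)) st = resample q n g (loads st) := by
  have hdisj : ∀ x ∈ List.range' a q, x ∉ ps.toFinset := by
    intro x hx h
    have := ha x (List.mem_toFinset.1 h)
    have := (List.mem_range'_1.1 hx).1
    omega
  rw [fillResample, ex_append, ex_inserts List.nodup_range' (Subset.refl ps.toFinset) hdisj
    (Φ := fun A L₁ => (G ^ n) (fun L₂ => (G ^ q) g (L₂ - (L₁ - loads A))) L₁) _ hst,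
    List.length_range', resample]
  · simp only [fun b => inter_eq_left.2 (hst b)]
  intro s₁ hs₁
  -- the sample consists of all balls that do not belong to the old block
  have hsample : loads (fun b => s₁ b ∩ (List.range' a q).toFinset)
      = loads s₁ - loads (fun b => s₁ b ∩ ps.toFinset) := by
    rw [← loads_sdiff]
    congr 1
    ext b z
    simp only [mem_inter, mem_sdiff, List.mem_toFinset]
    constructor
    · rintro ⟨h1, h2⟩
      exact ⟨h1, fun h => hdisj z h2 (List.mem_toFinset.2 h)⟩
    · rintro ⟨h1, h2⟩
      rcases mem_union.1 (hs₁ b h1) with h | h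
      · exact absurd (List.mem_toFinset.1 h) h2
      · exact ⟨h1, List.mem_toFinset.1 h⟩
  rw [ex_append, ex_inserts List.nodup_range' (subset_union_right :
    (List.range' a q).toFinset ⊆ ps.toFinset ∪ _) _
    (Φ := fun A L => (G ^ q) g (L - loads A)) _ hs₁, List.length_range', hsample]
  · intro x hx h
    have h1 := (List.mem_range'_1.1 hx).1
    rcases mem_union.1 h with h | h
    · have := ha x (List.mem_toFinset.1 h)
      omega
    · have := (List.mem_range'_1.1 (List.mem_toFinset.1 h)).2
      omega
  · intro s₂ hs₂
    rw [ex_append, ex_deletes, ← loads_sdiff,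
      ex_inserts List.nodup_range' (empty_subset _) _ (Φ := fun _ L => g L) (fun _ _ => rfl)
        (fun b => sdiff_subset.trans (hs₂ b)), List.length_range']
    intro x hx h
    have h1 := (List.mem_range'_1.1 hx).1
    rcases mem_union.1 h with h | h
    · rcases mem_union.1 h with h | h
      · have := ha x (List.mem_toFinset.1 h)
        omega
      · have := (List.mem_range'_1.1 (List.mem_toFinset.1 h)).2
        omega
    · have := (List.mem_range'_1.1 (List.mem_toFinset.1 h)).2
      omega

/-! ### The constraints on the adversary -/

lemma admissible_inserts {m : ℕ} {xs : List ℕ} {used present : Finset ℕ} {σ : List Op}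
    (hxs : xs.Nodup) (hused : ∀ x ∈ xs, x ∉ used) (hm : #present + xs.length ≤ m)
    (hσ : Admissible m (used ∪ xs.toFinset) (present ∪ xs.toFinset) σ) :
    Admissible m used present (inserts xs ++ σ) := by
  induction xs generalizing used present with
  | nil => simpa [inserts] using hσ
  | cons x xs ih =>
    rw [List.length_cons] at hm
    have hx := List.nodup_cons.1 hxs
    refine ⟨hused x List.mem_cons_self, by omega, ih hx.2 (fun z hz h => ?_) ?_ ?_⟩
    · rcases mem_insert.1 h with rfl | h
      · exact hx.1 hz
      · exact hused z (List.mem_cons_of_mem x hz) h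
    · have := card_insert_le x present
      omega
    · simpa using hσ

lemma admissible_deletes {m : ℕ} {ds : List ℕ} {used present : Finset ℕ} {σ : List Op}
    (hds : ds.Nodup) (hpresent : ∀ x ∈ ds, x ∈ present)
    (hσ : Admissible m used (present \ ds.toFinset) σ) :
    Admissible m used present (deletes ds ++ σ) := by
  induction ds generalizing present with
  | nil => simpa [deletes] using hσ
  | cons x ds ih =>
    have hx := List.nodup_cons.1 hds
    refine ⟨hpresent x List.mem_cons_self, ih hx.2 (fun z hz => ?_) ?_⟩
    · refine mem_erase.2 ⟨?_, hpresent z (List.mem_cons_of_mem x hz)⟩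
      rintro rfl
      exact hx.1 hz
    · convert hσ using 1
      ext z
      simp only [mem_sdiff, mem_erase, List.toFinset_cons, mem_insert]
      tauto

lemma admissible_rounds {m s : ℕ} {fin : List ℕ → ℕ → List Op} (hs : 2 * s ≤ m)
    (hfin : ∀ ps a used, ps.Nodup → ps.length ≤ s → (∀ x ∈ ps, x < a) → (∀ x ∈ used, x < a) →
      Admissible m used ps.toFinset (fin ps a))
    (t : ℕ) (ps : List ℕ) (a : ℕ) (used : Finset ℕ) (hps : ps.Nodup) (hlen : ps.length ≤ s)
    (ha : ∀ x ∈ ps, x < a) (hused : ∀ x ∈ used, x < a) :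
    Admissible m used ps.toFinset (rounds fin s t ps a) := by
  induction t generalizing ps a used with
  | zero => exact hfin ps a used hps hlen ha hused
  | succ t ih =>
    refine admissible_inserts List.nodup_range' (fun x hx h => ?_) ?_
      (admissible_deletes hps (fun x hx => mem_union_left _ (List.mem_toFinset.2 hx)) ?_)
    · have := hused x h
      have := (List.mem_range'_1.1 hx).1
      omega
    · have := List.toFinset_card_le ps
      rw [List.length_range']
      omega
    · have h1 : (ps.toFinset ∪ (List.range' a s).toFinset) \ ps.toFinset
          = (List.range' a s).toFinset := by
        rw [union_sdiff_left, Finset.sdiff_eq_self_iff_disjoint, disjoint_left]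
        intro x hx h
        have := ha x (List.mem_toFinset.1 h)
        have := (List.mem_range'_1.1 (List.mem_toFinset.1 hx)).1
        omega
      rw [h1]
      refine ih _ _ _ List.nodup_range' (by simp) (fun x hx => (List.mem_range'_1.1 hx).2) ?_
      intro x hx
      rcases mem_union.1 hx with h | h
      · have := hused x h
        omega
      · exact (List.mem_range'_1.1 (List.mem_toFinset.1 h)).2

lemma admissible_fill {m n : ℕ} (ps : List ℕ) (a : ℕ) (used : Finset ℕ) (hlen : ps.length + n ≤ m)
    (hused : ∀ x ∈ used, x < a) : Admissible m used ps.toFinset (fill n ps a) := by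
  rw [fill, ← List.append_nil (inserts _)]
  refine admissible_inserts List.nodup_range' (fun x hx h => ?_) ?_ trivial
  · have := hused x h
    have := (List.mem_range'_1.1 hx).1
    omega
  · have := List.toFinset_card_le ps
    rw [List.length_range']
    omega

lemma admissible_fillResample {m q n : ℕ} (ps : List ℕ) (a : ℕ) (used : Finset ℕ)
    (hlen : ps.length + q + n ≤ m) (hused : ∀ x ∈ used, x < a) :
    Admissible m used ps.toFinset (fillResample q n ps a) := by
  have hcard := List.toFinset_card_le ps
  have hmem : ∀ {x b k : ℕ}, x ∈ (List.range' b k).toFinset → b ≤ x ∧ x < b + k :=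
    fun h => List.mem_range'_1.1 (List.mem_toFinset.1 h)
  have hcr : ∀ b k : ℕ, #(List.range' b k).toFinset ≤ k := by
    intro b k
    simpa using List.toFinset_card_le (List.range' b k)
  refine admissible_inserts List.nodup_range' (fun x hx h => ?_) ?_
    (admissible_inserts List.nodup_range' (fun x hx h => ?_) ?_
    (admissible_deletes List.nodup_range' (fun x hx => ?_) ?_))
  · have := hused x h
    have := (List.mem_range'_1.1 hx).1
    omega
  · rw [List.length_range']
    omega
  · have h1 := (List.mem_range'_1.1 hx).1
    rcases mem_union.1 h with h | h
    · have := hused x h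
      omega
    · have := hmem h
      omega
  · have h1 := card_union_le ps.toFinset (List.range' a q).toFinset
    have h2 := hcr a q
    rw [List.length_range']
    omega
  · exact mem_union_left _ (mem_union_right _ (List.mem_toFinset.2 hx))
  · rw [← List.append_nil (inserts _)]
    refine admissible_inserts List.nodup_range' (fun x hx h => ?_) ?_ trivial
    · have h1 := (List.mem_range'_1.1 hx).1
      rcases mem_union.1 h with h | h
      · rcases mem_union.1 h with h | h
        · have := hused x h
          omega
        · have := hmem h
          omega
      · have := hmem h
        omega
    · have h1 : (ps.toFinset ∪ (List.range' a q).toFinset ∪ (List.range' (a + q) n).toFinset)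
          \ (List.range' a q).toFinset ⊆ ps.toFinset ∪ (List.range' (a + q) n).toFinset := by
        intro x
        simp only [mem_sdiff, mem_union]
        tauto
      have h2 := (card_le_card h1).trans (card_union_le _ _)
      have h3 := hcr (a + q) n
      rw [List.length_range']
      omega

lemma length_rounds_le {fin : List ℕ → ℕ → List Op} {s k : ℕ}
    (hfin : ∀ ps a, (fin ps a).length ≤ k) (t : ℕ) (ps : List ℕ) (a : ℕ) (hps : ps.length ≤ s) :
    (rounds fin s t ps a).length ≤ t * (2 * s) + k := by
  induction t generalizing ps a with
  | zero => simpa [rounds] using hfin ps a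
  | succ t ih =>
    have := ih (List.range' a s) (a + s) (by simp)
    simp only [rounds, inserts, deletes, List.length_append, List.length_map, List.length_range']
    rw [add_mul]
    omega

end TwoChoice

open TwoChoice in
theorem mainTheorem2 :
    ∃ (c p : ℝ) (C d m₀ : ℕ), 0 < c ∧ 0 < p ∧
      ∀ m : ℕ, m₀ ≤ m →
        ∃ σ : List TwoChoice.Op,
          TwoChoice.Admissible m ∅ ∅ σ ∧
          σ.length ≤ C * m ^ d ∧
          ENNReal.ofReal p ≤
            (TwoChoice.run TwoChoice.greedy σ (TwoChoice.State.empty (Fin 4))).toOuterMeasure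
              {s | ∃ b : Fin 4, (m : ℝ) / 4 + c * √(m : ℝ) ≤ (TwoChoice.load s b : ℝ)} := by
  obtain ⟨m₀, hm₀⟩ := Filter.eventually_atTop.1 exists_heavy_round
  refine ⟨1 / 12000, 1 / 200000000000, 4, 3, m₀ + 1, by norm_num, by norm_num, fun m hm => ?_⟩
  obtain ⟨t, ht, h⟩ := hm₀ m (by omega)
  set g := ind (Heavy ((m : ℝ) / 4 + 1 / 12000 * √m)) with hg
  have hind : Set.indicator {s : State (Fin 4) | ∃ b : Fin 4,
      (m : ℝ) / 4 + 1 / 12000 * √(m : ℝ) ≤ (load s b : ℝ)} 1 = fun s => g (loads s) := by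
    ext s
    simp [hg, ind, Heavy, loads, Set.indicator_apply]
  -- each of the at most `m ^ 2` rounds has at most `m` operations
  have hlen : ∀ k ≤ 3 * m, t * (2 * (m / 2)) + k ≤ 4 * m ^ 3 := by
    intro k hk
    have h1 : t ≤ m ^ 2 := by
      have h2 : 97 * (m / 100) ^ 2 ≤ (100 * (m / 100)) ^ 2 := by rw [mul_pow]; gcongr; norm_num
      have h3 : (100 * (m / 100)) ^ 2 ≤ m ^ 2 := by gcongr; omega
      omega
    have h2 : t * (2 * (m / 2)) ≤ m ^ 2 * m := by gcongr; omega
    have h3 : m ≤ m ^ 3 := Nat.le_self_pow (by norm_num) m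
    have h4 : m ^ 3 = m ^ 2 * m := pow_succ m 2
    omega
  have hempty : loads (State.empty (Fin 4)) = 0 := by
    ext b
    simp [loads, load, State.empty]
  rcases h with h | h
  · refine ⟨rounds (fill (m - m / 2)) (m / 2) t [] 0, ?_, ?_, ?_⟩
    · exact admissible_rounds (by omega)
        (fun ps a used _ hl _ hu => admissible_fill ps a used (by omega) hu)
        t [] 0 ∅ List.nodup_nil (by simp) (by simp) (by simp)
    · refine (length_rounds_le (k := m - m / 2) (fun ps a => ?_) t [] 0 (by simp)).trans
        (hlen _ (by omega))
      simp [fill, inserts]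
    · rw [run_toOuterMeasure, hind, ex_rounds (ex_fill _ g) _ _ _ _ _ (by simp)
        (by simp [State.empty]), hempty]
      exact ENNReal.ofReal_le_ofReal h
  · refine ⟨rounds (fillResample (m / 1800) (m - m / 2 - m / 1800)) (m / 2) t [] 0, ?_, ?_, ?_⟩
    · exact admissible_rounds (by omega)
        (fun ps a used _ hl _ hu => admissible_fillResample ps a used (by omega) hu)
        t [] 0 ∅ List.nodup_nil (by simp) (by simp) (by simp)
    · refine (length_rounds_le (k := 3 * m) (fun ps a => ?_) t [] 0 (by simp)).trans
        (hlen _ le_rfl)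
      simp only [fillResample, inserts, deletes, List.length_append, List.length_map,
        List.length_range']
      omega
    · rw [run_toOuterMeasure, hind, ex_rounds (ex_fillResample _ _ g) _ _ _ _ _ (by simp)
        (by simp [State.empty]), hempty]
      exact ENNReal.ofReal_le_ofReal h
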